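/- Write $\mathbb N=\{1,2,3,\dots\}$ and $\mathbb N_0=\mathbb N\cup\{0\}$. A composition is a tuple $\mathbf k=(k_1,\dots,k_r)\in\mathbb N^r$ with $r\ge 1$; put $|\mathbf k|=k_1+\cdots+k_r$, $\mathrm{dep}(\mathbf k)=r$, $\overleftarrow{\mathbf k}=(k_r,\dots,k_1)$ and $\mathbf k_+=(k_1+1,k_2,\dots,k_r)$. The Hoffman dual $\mathbf k^\vee$ is the composition of $|\mathbf k|$ whose set of proper partial sums is the complement in $\{1,\dots,|\mathbf k|-1\}$ of the set of proper partial sums $\{k_1,\,k_1+k_2,\,\dots,\,k_1+\cdots+k_{r-1}\}$ of $\mathbf k$. For $\mathbf j\in\mathbb N_0^r$ put $|\mathbf j|=j_1+\cdots+j_r$, $\mathrm{dep}(\mathbf j)=r$ and $B(\mathbf k;\mathbf j)=\prod_{i=1}^r\binom{k_i+j_i-1}{j_i}$. For $0<x<1$ let $$\mathrm{Li}_{\mathbf k}(x)=\sum_{n_1>\cdots>n_r>0}\frac{x^{n_1}}{n_1^{k_1}\cdots n_r^{k_r}},\qquad \mathrm A(\mathbf k;x)=2^r\sum_{\substack{n_1>\cdots>n_r>0\\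 n_j\equiv r+1-j\ (\mathrm{mod}\ 2)}}\frac{x^{n_1}}{n_1^{k_1}\cdots n_r^{k_r}},$$ and for $k_1\ge2$ and $a\in\mathbb C\setminus\{0,-1,-2,\dots\}$ let $$\zeta(\mathbf k;a)=\sum_{n_1>\cdots>n_r>0}\ \prod_{j=1}^r\frac1{(n_j+a-1)^{k_j}},\qquad T(\mathbf k;a)=\sum_{m_1>\cdots>m_r>0}\ \prod_{j=1}^r\frac{2}{(2m_j-r-2+j+a)^{k_j}}.$$ **Theorem.** Let $\mathbf k$ be a composition, $k\in\mathbb N$, and $n=|\mathbf k|+1-\mathrm{dep}(\mathbf k)$. Then $\overleftarrow{\mathbf k}^{\vee}$ has depth $n$, and for every $\alpha\in\mathbb C\setminus\mathbb N$ $$\int_0^1\frac{\mathrm{Li}_{\mathbf k}(x)\log^k(1-x)}{x(1-x)^\alpha}\,dx=(-1)^kk!\sum_{\substack{\mathbf j\in\mathbb N_0^n\\ |\mathbf j|=k}}B\big((\overleftarrow{\mathbf k}^\vee)_+;\mathbf j\big)\,\zeta\big((\overleftarrow{\mathbf k}^\vee)_++\mathbf j;1-\alpha\big),$$ $$\int_0^1\frac{\mathrm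 A(\mathbf k;x)\log^k\big(\frac{1-x}{1+x}\big)}{x\big(\frac{1-x}{1+x}\big)^\alpha}\,dx=(-1)^kk!\sum_{\substack{\mathbf j\in\mathbb N_0^n\\ |\mathbf j|=k}}B\big((\overleftarrow{\mathbf k}^\vee)_+;\mathbf j\big)\,T\big((\overleftarrow{\mathbf k}^\vee)_++\mathbf j;1-\alpha\big).$$ Here the integrals converge absolutely for $\mathrm{Re}\,\alpha<1$, and for the other $\alpha\in\mathbb C\setminus\mathbb N$ the left-hand sides denote the holomorphic continuation in $\alpha$ of the integrals from $\{\mathrm{Re}\,\alpha<1\}$ to $\mathbb C\setminus\mathbb N$, which exists; the series on the right-hand sides converge absolutely for all $\alpha\in\mathbb C\setminus\mathbb N$. -/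

import Mathlib

open scoped BigOperators

noncomputable section

/-- The Hoffman dual of a composition `c` of `w`: the composition of `w` whose set of proper
partial sums is the complement in `{1, …, w - 1}` of the set of proper partial sums of `c`.
(`Composition.boundaries` is the set of all partial sums, including `0` and `w`.) -/
def hoffmanDual {w : ℕ} (c : Composition w) : Composition w :=
  CompositionAsSet.toComposition
    { boundaries := Finset.univ.filter fun i => i = 0 ∨ i = Fin.last w ∨ i ∉ c.boundaries
      zero_mem := by simp
      getLast_mem := by simp }

/-- `k₊ = (k₁ + 1, k₂, …, k_r)`. -/
def raiseFirst {r : ℕ} (k : Fin r → ℕ) : Fin r → ℕ :=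
  fun i => if (i : ℕ) = 0 then k i + 1 else k i

/-- `B(k; j) = ∏ᵢ binom(kᵢ + jᵢ - 1, jᵢ)`. -/
def binomProd {r : ℕ} (k j : Fin r → ℕ) : ℕ :=
  ∏ i, (k i + j i - 1).choose (j i)

/-- The set of all `(n₁, …, n_r)` with `n₁ > n₂ > ⋯ > n_r > 0`. -/
def decTuples (r : ℕ) : Set (Fin r → ℕ) :=
  {n | StrictAnti n ∧ ∀ i, 0 < n i}

/-- The set of all `(n₁, …, n_r)` with `n₁ > n₂ > ⋯ > n_r > 0` and `n_j ≡ r + 1 - j (mod 2)`;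
the index `i = j - 1` starts at `0`. -/
def parityTuples (r : ℕ) : Set (Fin r → ℕ) :=
  {n | n ∈ decTuples r ∧ ∀ i : Fin r, n i ≡ r - (i : ℕ) [MOD 2]}

/-- The first entry `n₁` of a tuple (`0` for the empty tuple). -/
def firstEntry {r : ℕ} (n : Fin r → ℕ) : ℕ :=
  if h : 0 < r then n ⟨0, h⟩ else 0

/-- The multiple polylogarithm `Li_k(x)`. -/
def multiPolylog {r : ℕ} (k : Fin r → ℕ) (x : ℝ) : ℝ :=
  ∑' n : decTuples r, x ^ firstEntry n.1 / ∏ i, (n.1 i : ℝ) ^ k i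

/-- The level two function `A(k; x)`. -/
def multiA {r : ℕ} (k : Fin r → ℕ) (x : ℝ) : ℝ :=
  2 ^ r * ∑' n : parityTuples r, x ^ firstEntry n.1 / ∏ i, (n.1 i : ℝ) ^ k i

/-- The general term of the series defining the Hurwitz-type multiple zeta value `ζ(k; a)`. -/
def hurwitzZetaTerm {r : ℕ} (k : Fin r → ℕ) (a : ℂ) (n : decTuples r) : ℂ :=
  1 / ∏ i, ((n.1 i : ℂ) + a - 1) ^ k i

/-- The Hurwitz-type multiple zeta value `ζ(k; a)`. -/
def hurwitzMZV {r : ℕ} (k : Fin r → ℕ) (a : ℂ) : ℂ :=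
  ∑' n, hurwitzZetaTerm k a n

/-- The general term of the series defining the Hurwitz-type multiple `T`-value `T(k; a)`. For
`1 ≤ j ≤ r` the `j`-th factor of the denominator is `(2 m_j - r - 2 + j + a) ^ k_j`; here
`j = i + 1`. -/
def hurwitzTTerm {r : ℕ} (k : Fin r → ℕ) (a : ℂ) (m : decTuples r) : ℂ :=
  2 ^ r / ∏ i : Fin r, (2 * (m.1 i : ℂ) - (r : ℂ) - 1 + ((i : ℕ) : ℂ) + a) ^ k i

/-- The Hurwitz-type multiple `T`-value `T(k; a)`. -/
def hurwitzMTV {r : ℕ} (k : Fin r → ℕ) (a : ℂ) : ℂ :=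
  ∑' m, hurwitzTTerm k a m

/-- The exponents `(k̄^∨)₊`, where `k̄` is the reversal of `k` and `∨` is the Hoffman dual. -/
def dualExponents {w : ℕ} (c : Composition w) : Fin (hoffmanDual c.reverse).length → ℕ :=
  raiseFirst (hoffmanDual c.reverse).blocksFun

/-- The integrand `Li_k(x) log^m(1 - x) / (x (1 - x)^α)`. -/
def polylogIntegrand {r : ℕ} (k : Fin r → ℕ) (m : ℕ) (α : ℂ) (x : ℝ) : ℂ :=
  ((multiPolylog k x * Real.log (1 - x) ^ m : ℝ) : ℂ) / ((x : ℂ) * ((1 - x : ℝ) : ℂ) ^ α)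

/-- The integrand `A(k; x) log^m((1 - x) / (1 + x)) / (x ((1 - x) / (1 + x))^α)`. -/
def multiAIntegrand {r : ℕ} (k : Fin r → ℕ) (m : ℕ) (α : ℂ) (x : ℝ) : ℂ :=
  ((multiA k x * Real.log ((1 - x) / (1 + x)) ^ m : ℝ) : ℂ) /
    ((x : ℂ) * (((1 - x) / (1 + x) : ℝ) : ℂ) ^ α)

/-- The set `ℂ ∖ {1, 2, 3, …}`. -/
def complexMinusPosNat : Set ℂ :=
  {α | ∀ n : ℕ, 0 < n → α ≠ n}

end

/-! Both formulas are the cases N = 1 and N = 2 of one argument. The involution φ(t) = (1 - t)/(1 +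
(N - 1)t) of (0, 1) exchanges the forms ω₀ = dt/t and ω₁ = N dt/((1 - t)(1 + (N - 1)t)). For these
two N the denominator of ω₁ is 1 - t^N, and expanding it geometrically identifies Li_k, respectively
A(k; ·), with the iterated integral along the word 0^{k₁-1} 1 ⋯ 0^{k_r-1} 1 (`iterInt_compWord` at α
= 0).

For real α < 1 consider the integral of Li_k(t) φ(t)^{-α} dt/t, or its analogue with A. Tonelli and
the substitution φ turn it into an iterated integral that starts from t^{-α} and runs along the
reversed and complemented word (`lintegral_iterInt_duality`). By `compWord_dualExponents` that word
belongs to the exponents K = (k̄^∨)₊, so the value is the Hurwitz-type series `levelSum`. Working in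
`ℝ≥0∞` makes every exchange free; finiteness is read off from the series at the end.

The logarithms come from differentiating in α. With X = -log φ, the integral above is the moment
generating function of X under the measure Li_k(t) dt/t, and its m-th derivative inserts X^m =
(-1)^m log^m φ. The identity theorem carries the equality with `levelSum` from real α to Re α < 1
(`complexMGF_eqOn_levelSum`). The series converges normally near each point of ℂ ∖ ℕ, so its m-th
derivative supplies the continuation, and the Leibniz rule applied term by term
(`iteratedDeriv_levelSum`) produces the factors m! B(K; j). -/

open MeasureTheory Set
open scoped ENNReal

noncomputable section

/-! ### The involution, iterated integrals and their duality -/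

/-- The involution `t ↦ (1 - t) / (1 + (N - 1) t)` of `(0, 1)`. -/
def levelInvol (N : ℕ) (t : ℝ) : ℝ := (1 - t) / (1 + ((N : ℝ) - 1) * t)

/-- The densities of the two one-forms `dt / t` and `N dt / ((1 - t) (1 + (N - 1) t))`. -/
def formDensity (N : ℕ) : Bool → ℝ → ℝ
  | false, t => 1 / t
  | true, t => N / ((1 - t) * (1 + ((N : ℝ) - 1) * t))

/-- The iterated integral of a word in the two one-forms, applied to the initial function `g`. -/
def iterInt (N : ℕ) (g : ℝ → ℝ≥0∞) : List Bool → ℝ → ℝ≥0∞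
  | [] => g
  | b :: v => fun x => ∫⁻ t in Ioo 0 x, iterInt N g v t * ENNReal.ofReal (formDensity N b t)

theorem level_den_pos {N : ℕ} (hN : 1 ≤ N) {t : ℝ} (ht : 0 ≤ t) :
    0 < 1 + ((N : ℝ) - 1) * t := by
  have : (1 : ℝ) ≤ N := by exact_mod_cast hN
  nlinarith [mul_nonneg (sub_nonneg.2 this) ht]

theorem levelInvol_levelInvol {N : ℕ} (hN : 1 ≤ N) {t : ℝ} (ht : 0 ≤ t) :
    levelInvol N (levelInvol N t) = t := by
  have h := level_den_pos hN ht
  have hN' : (N : ℝ) ≠ 0 := by positivity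
  have h2 : 1 + ((N : ℝ) - 1) * ((1 - t) / (1 + ((N : ℝ) - 1) * t))
      = N / (1 + ((N : ℝ) - 1) * t) := by
    field_simp
    ring
  have h3 : 1 - (1 - t) / (1 + ((N : ℝ) - 1) * t) = N * t / (1 + ((N : ℝ) - 1) * t) := by
    rw [eq_div_iff h.ne', sub_mul, div_mul_cancel₀ _ h.ne']
    ring
  unfold levelInvol
  rw [h2, h3, div_div_div_cancel_right₀ h.ne', mul_div_cancel_left₀ _ hN']

theorem levelInvol_pos {N : ℕ} (hN : 1 ≤ N) {t : ℝ} (ht : 0 ≤ t) (ht1 : t < 1) :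
    0 < levelInvol N t :=
  div_pos (by linarith) (level_den_pos hN ht)

theorem levelInvol_lt {N : ℕ} (hN : 1 ≤ N) {s t : ℝ} (hs : 0 ≤ s) (hst : s < t) :
    levelInvol N t < levelInvol N s := by
  have h1 := level_den_pos hN hs
  have h2 := level_den_pos hN (hs.trans hst.le)
  have hN' : (1 : ℝ) ≤ N := by exact_mod_cast hN
  unfold levelInvol
  rw [div_lt_div_iff₀ h2 h1]
  nlinarith

theorem levelInvol_zero (N : ℕ) : levelInvol N 0 = 1 := by simp [levelInvol]

theorem levelInvol_image_Ioo {N : ℕ} (hN : 1 ≤ N) {s : ℝ} (hs : 0 ≤ s) :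
    levelInvol N '' Ioo s 1 = Ioo 0 (levelInvol N s) := by
  ext u
  constructor
  · rintro ⟨t, ht, rfl⟩
    exact ⟨levelInvol_pos hN (hs.trans ht.1.le) ht.2, levelInvol_lt hN hs ht.1⟩
  · rintro ⟨h0, h1⟩
    refine ⟨levelInvol N u, ⟨?_, ?_⟩, levelInvol_levelInvol hN h0.le⟩
    · have := levelInvol_lt hN h0.le h1
      rwa [levelInvol_levelInvol hN hs] at this
    · have := levelInvol_lt hN le_rfl h0
      rwa [levelInvol_zero] at this

theorem hasDerivAt_levelInvol {N : ℕ} (hN : 1 ≤ N) {t : ℝ} (ht : 0 ≤ t) :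
    HasDerivAt (levelInvol N) (-(N : ℝ) / (1 + ((N : ℝ) - 1) * t) ^ 2) t := by
  have h := level_den_pos hN ht
  have h1 : HasDerivAt (fun t : ℝ => 1 - t) (-1) t := by
    simpa using (hasDerivAt_id t).const_sub 1
  have h2 : HasDerivAt (fun t : ℝ => 1 + ((N : ℝ) - 1) * t) ((N : ℝ) - 1) t := by
    simpa using ((hasDerivAt_id t).const_mul ((N : ℝ) - 1)).const_add 1
  convert! h1.div h2 h.ne' using 1
  congr 1
  ring

/-- Pullback along the involution exchanges the two forms. The Jacobian enters with its absolute
value, as the change of variables for Lebesgue integrals requires. -/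
theorem formDensity_levelInvol {N : ℕ} (hN : 1 ≤ N) {t : ℝ} (ht : t ∈ Ioo (0 : ℝ) 1) (a : Bool) :
    (N : ℝ) / (1 + ((N : ℝ) - 1) * t) ^ 2 * formDensity N (!a) (levelInvol N t)
      = formDensity N a t := by
  have h := level_den_pos hN ht.1.le
  have hN' : (N : ℝ) ≠ 0 := by positivity
  have h1 : 1 - t ≠ 0 := by linarith [ht.2]
  have h0 : t ≠ 0 := ht.1.ne'
  have h2 : 1 + ((N : ℝ) - 1) * ((1 - t) / (1 + ((N : ℝ) - 1) * t))
      = N / (1 + ((N : ℝ) - 1) * t) := by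
    field_simp
    ring
  have h3 : 1 - (1 - t) / (1 + ((N : ℝ) - 1) * t) = N * t / (1 + ((N : ℝ) - 1) * t) := by
    rw [eq_div_iff h.ne', sub_mul, div_mul_cancel₀ _ h.ne']
    ring
  cases a
  · simp only [Bool.not_false, formDensity, levelInvol, h2, h3]
    field_simp
  · simp only [Bool.not_true, formDensity, levelInvol]
    field_simp

theorem lintegral_comp_levelInvol {N : ℕ} (hN : 1 ≤ N) (A : ℝ → ℝ≥0∞) (a : Bool) {s : ℝ}
    (hs : 0 ≤ s) :
    ∫⁻ t in Ioo s 1, A (levelInvol N t) * ENNReal.ofReal (formDensity N a t)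
      = ∫⁻ u in Ioo 0 (levelInvol N s), A u * ENNReal.ofReal (formDensity N (!a) u) := by
  rw [← levelInvol_image_Ioo hN hs, lintegral_image_eq_lintegral_abs_deriv_mul measurableSet_Ioo
    (fun t ht => (hasDerivAt_levelInvol hN (hs.trans ht.1.le)).hasDerivWithinAt)]
  · refine setLIntegral_congr_fun measurableSet_Ioo fun t ht => ?_
    have ht' : t ∈ Ioo (0 : ℝ) 1 := ⟨hs.trans_lt ht.1, ht.2⟩
    have hpos : 0 ≤ (N : ℝ) / (1 + ((N : ℝ) - 1) * t) ^ 2 := by positivity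
    have habs : |-(N : ℝ) / (1 + ((N : ℝ) - 1) * t) ^ 2| = N / (1 + ((N : ℝ) - 1) * t) ^ 2 := by
      rw [neg_div, abs_neg, abs_of_nonneg hpos]
    simp only [habs]
    rw [mul_left_comm, ← ENNReal.ofReal_mul hpos, formDensity_levelInvol hN ht']
  · intro x hx y hy hxy
    rw [← levelInvol_levelInvol hN (hs.trans hx.1.le), hxy,
      levelInvol_levelInvol hN (hs.trans hy.1.le)]

theorem measurable_formDensity (N : ℕ) (b : Bool) : Measurable (formDensity N b) := by
  cases b
  · exact measurable_const.div measurable_id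
  · unfold formDensity
    fun_prop

theorem measurable_levelInvol (N : ℕ) : Measurable (levelInvol N) := by
  unfold levelInvol
  fun_prop

/-- After at least one integration the function is monotone in its endpoint, so no induction on the
word is needed. -/
theorem measurable_iterInt (N : ℕ) {g : ℝ → ℝ≥0∞} (hg : Measurable g) (v : List Bool) :
    Measurable (iterInt N g v) := by
  cases v with
  | nil => exact hg
  | cons b v =>
    refine Monotone.measurable fun x y hxy => ?_
    exact lintegral_mono_set (Ioo_subset_Ioo_right hxy)

/-- Exchanging the order of integration over the triangle `0 < s < t < 1`. -/
theorem lintegral_triangle_swap {f p : ℝ → ℝ≥0∞} (hf : Measurable f) (hp : Measurable p) :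
    ∫⁻ t in Ioo (0 : ℝ) 1, p t * ∫⁻ s in Ioo 0 t, f s
      = ∫⁻ s in Ioo (0 : ℝ) 1, f s * ∫⁻ t in Ioo s 1, p t := by
  have h1 : ∀ t ∈ Ioo (0 : ℝ) 1, p t * ∫⁻ s in Ioo 0 t, f s
      = ∫⁻ s in Ioo (0 : ℝ) 1, {q : ℝ × ℝ | q.2 < q.1}.indicator (fun q => p q.1 * f q.2) (t, s) := by
    intro t ht
    have : ∀ s, {q : ℝ × ℝ | q.2 < q.1}.indicator (fun q => p q.1 * f q.2) (t, s)
        = (Iio t).indicator (fun s => p t * f s) s := by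
      intro s
      simp [indicator]
    simp_rw [this]
    rw [lintegral_indicator measurableSet_Iio, Measure.restrict_restrict measurableSet_Iio,
      lintegral_const_mul _ hf]
    congr 3
    ext s
    simp only [mem_Ioo, mem_inter_iff, mem_Iio]
    constructor
    · rintro ⟨a, b⟩
      exact ⟨b, a, b.trans ht.2⟩
    · rintro ⟨a, b, c⟩
      exact ⟨b, a⟩
  have h2 : ∀ s ∈ Ioo (0 : ℝ) 1, f s * ∫⁻ t in Ioo s 1, p t
      = ∫⁻ t in Ioo (0 : ℝ) 1, {q : ℝ × ℝ | q.2 < q.1}.indicator (fun q => p q.1 * f q.2) (t, s) := by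
    intro s hs
    have : ∀ t, {q : ℝ × ℝ | q.2 < q.1}.indicator (fun q => p q.1 * f q.2) (t, s)
        = (Ioi s).indicator (fun t => f s * p t) t := by
      intro t
      simp [indicator, mul_comm]
    simp_rw [this]
    rw [lintegral_indicator measurableSet_Ioi, Measure.restrict_restrict measurableSet_Ioi,
      lintegral_const_mul _ hp]
    congr 3
    ext t
    simp only [mem_Ioo, mem_inter_iff, mem_Ioi]
    constructor
    · rintro ⟨a, b⟩
      exact ⟨a, hs.1.trans a, b⟩
    · rintro ⟨a, b, c⟩
      exact ⟨a, c⟩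
  rw [setLIntegral_congr_fun measurableSet_Ioo h1, setLIntegral_congr_fun measurableSet_Ioo h2]
  refine lintegral_lintegral_swap ?_
  refine Measurable.aemeasurable ?_
  exact ((hp.comp measurable_fst).mul (hf.comp measurable_snd)).indicator
    (measurableSet_lt measurable_snd measurable_fst)

/-- Duality for iterated integrals: all letters of `w` can be moved to the other factor. -/
theorem lintegral_iterInt_duality {N : ℕ} (hN : 1 ≤ N) {g : ℝ → ℝ≥0∞} (hg : Measurable g)
    (w v : List Bool) (a : Bool) :
    ∫⁻ t in Ioo (0 : ℝ) 1, iterInt N g v (levelInvol N t) * ENNReal.ofReal (formDensity N a t)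
        * iterInt N (fun _ => 1) w t
      = iterInt N g ((w.map not).reverse ++ (!a) :: v) 1 := by
  induction w generalizing v a with
  | nil =>
    simp only [iterInt, mul_one, List.map_nil, List.reverse_nil, List.nil_append]
    rw [lintegral_comp_levelInvol hN _ _ le_rfl, levelInvol_zero]
  | cons b w ih =>
    have hm := measurable_iterInt N (measurable_const (a := (1 : ℝ≥0∞))) w
    have hv := measurable_iterInt N hg v
    have hden := fun c => (measurable_formDensity N c).ennreal_ofReal
    have := lintegral_triangle_swap (hm.mul (hden b))
      ((hv.comp (measurable_levelInvol N)).mul (hden a))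
    simp only [iterInt, Pi.mul_apply, Function.comp_apply] at this ⊢
    rw [this]
    -- The inner integral over (s, 1) becomes one over (0, φ(s)), which is one more letter in front
    -- of `v`. The letter `b` then takes over the role of `a`, whence the induction generalizes
    -- both.
    have key : ∀ s ∈ Ioo (0 : ℝ) 1, (iterInt N (fun _ => 1) w s * ENNReal.ofReal (formDensity N b s))
        * ∫⁻ t in Ioo s 1, iterInt N g v (levelInvol N t) * ENNReal.ofReal (formDensity N a t)
        = iterInt N g ((!a) :: v) (levelInvol N s) * ENNReal.ofReal (formDensity N b s)
          * iterInt N (fun _ => 1) w s := by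
      intro s hs
      rw [lintegral_comp_levelInvol hN _ _ hs.1.le]
      simp only [iterInt]
      ring
    rw [setLIntegral_congr_fun measurableSet_Ioo key, ih]
    simp

/-! ### Series expansion of the iterated integrals -/

/-- The denominators `N nᵢ - (N - 1) (r - i)` of the level `N` series. -/
def levelEntry (N : ℕ) {r : ℕ} (n : Fin r → ℕ) (i : Fin r) : ℝ :=
  N * (n i : ℝ) - ((N : ℝ) - 1) * ((r : ℝ) - (i : ℕ))

/-- The first denominator of the level `N` series (`0` for the empty tuple). -/
def levelFirst (N : ℕ) {r : ℕ} (n : Fin r → ℕ) : ℝ :=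
  N * (firstEntry n : ℝ) - ((N : ℝ) - 1) * r

theorem firstEntry_succ {r : ℕ} (n : Fin (r + 1) → ℕ) : firstEntry n = n 0 := by
  simp [firstEntry]

theorem cons_mem_decTuples {r : ℕ} {n : Fin r → ℕ} (hn : n ∈ decTuples r) (e : ℕ) :
    (Fin.cons (firstEntry n + e + 1) n : Fin (r + 1) → ℕ) ∈ decTuples (r + 1) := by
  refine ⟨?_, ?_⟩
  · rw [Fin.strictAnti_iff_succ_lt]
    intro i
    rw [Fin.cons_succ]
    cases r with
    | zero => exact i.elim0
    | succ r =>
      refine Fin.cases ?_ (fun j => ?_) i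
      · simp [firstEntry_succ]
      · have : n j.succ < n j.castSucc := hn.1 (Fin.castSucc_lt_succ)
        simpa [← Fin.succ_castSucc] using this
  · intro i
    refine Fin.cases ?_ (fun j => ?_) i
    · simp
    · simpa using hn.2 j

theorem tail_mem_decTuples {r : ℕ} {n : Fin (r + 1) → ℕ} (hn : n ∈ decTuples (r + 1)) :
    Fin.tail n ∈ decTuples r :=
  ⟨fun _ _ h => hn.1 (Fin.succ_lt_succ_iff.2 h), fun i => hn.2 i.succ⟩

theorem firstEntry_tail_lt {r : ℕ} {n : Fin (r + 1) → ℕ} (hn : n ∈ decTuples (r + 1)) :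
    firstEntry (Fin.tail n) < n 0 := by
  cases r with
  | zero => simpa [firstEntry] using hn.2 0
  | succ r =>
    rw [firstEntry_succ]
    exact hn.1 (Fin.succ_pos 0)

/-- A decreasing tuple is determined by its tail and by the size of its first jump. -/
def decTuplesCons (r : ℕ) : decTuples r × ℕ ≃ decTuples (r + 1) where
  toFun p := ⟨Fin.cons (firstEntry p.1.1 + p.2 + 1) p.1.1, cons_mem_decTuples p.1.2 p.2⟩
  invFun n := (⟨Fin.tail n.1, tail_mem_decTuples n.2⟩, n.1 0 - firstEntry (Fin.tail n.1) - 1)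
  left_inv p := by
    ext1
    · simp
    · simp only [Fin.cons_zero, Fin.tail_cons]
      omega
  right_inv n := by
    have h := firstEntry_tail_lt n.2
    refine Subtype.ext ?_
    have : firstEntry (Fin.tail n.1) + (n.1 0 - firstEntry (Fin.tail n.1) - 1) + 1 = n.1 0 := by
      omega
    simp only [this, Fin.cons_self_tail]

theorem levelEntry_cons_succ (N : ℕ) {r : ℕ} (a : ℕ) (n : Fin r → ℕ) (i : Fin r) :
    levelEntry N (Fin.cons a n : Fin (r + 1) → ℕ) i.succ = levelEntry N n i := by
  simp [levelEntry]

theorem levelEntry_cons_zero (N : ℕ) {r : ℕ} (e : ℕ) (n : Fin r → ℕ) :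
    levelEntry N (Fin.cons (firstEntry n + e + 1) n : Fin (r + 1) → ℕ) 0
      = levelFirst N n + N * e + 1 := by
  simp [levelEntry, levelFirst]
  ring

theorem levelFirst_succ (N : ℕ) {r : ℕ} (n : Fin (r + 1) → ℕ) :
    levelFirst N n = levelEntry N n 0 := by
  simp [levelEntry, levelFirst, firstEntry_succ]

/-- From index `i` on there are `r - i` distinct positive integers, the largest being `n i`. This
makes the natural subtraction in `parityEquiv` exact. -/
theorem sub_le_of_mem_decTuples {r : ℕ} {n : Fin r → ℕ} (hn : n ∈ decTuples r) (i : Fin r) :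
    r - (i : ℕ) ≤ n i := by
  induction r with
  | zero => exact i.elim0
  | succ r ih =>
    have ht := ih (tail_mem_decTuples hn)
    refine Fin.cases ?_ (fun j => ?_) i
    · cases r with
      | zero => simpa using Nat.succ_le_of_lt (hn.2 0)
      | succ r =>
        have h1 := ht 0
        have h2 : n 1 < n 0 := hn.1 (Fin.succ_pos 0)
        simp only [Fin.tail, Fin.succ_zero_eq_one, Fin.val_zero] at h1 ⊢
        omega
    · have := ht j
      simpa [Fin.tail] using this

/-- The level `N` denominators are natural numbers that are at least as large as the entries. -/
theorem exists_levelEntry_eq {N : ℕ} (hN : 1 ≤ N) {r : ℕ} {n : Fin r → ℕ} (hn : n ∈ decTuples r)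
    (i : Fin r) : ∃ q : ℕ, n i ≤ q ∧ levelEntry N n i = q := by
  have h := sub_le_of_mem_decTuples hn i
  obtain ⟨d, hd⟩ := Nat.exists_eq_add_of_le h
  obtain ⟨M, rfl⟩ := Nat.exists_eq_add_of_le hN
  -- With n_i = (r - i) + d, the denominator N n_i - (N - 1)(r - i) equals N d + (r - i).
  refine ⟨(1 + M) * d + (r - i), ?_, ?_⟩
  · rw [hd]
    nlinarith
  · have : ((r - (i : ℕ) : ℕ) : ℝ) = (r : ℝ) - (i : ℕ) := Nat.cast_sub i.2.le
    simp only [levelEntry, hd]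
    push_cast
    rw [this]
    ring

theorem one_le_levelEntry {N : ℕ} (hN : 1 ≤ N) {r : ℕ} {n : Fin r → ℕ} (hn : n ∈ decTuples r)
    (i : Fin r) : 1 ≤ levelEntry N n i := by
  obtain ⟨q, hq, h⟩ := exists_levelEntry_eq hN hn i
  rw [h]
  exact_mod_cast (hn.2 i).trans_le hq

theorem levelFirst_nonneg {N : ℕ} (hN : 1 ≤ N) {r : ℕ} {n : Fin r → ℕ} (hn : n ∈ decTuples r) :
    0 ≤ levelFirst N n := by
  cases r with
  | zero => simp [levelFirst, firstEntry]
  | succ r =>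
    rw [levelFirst_succ]
    exact zero_le_one.trans (one_le_levelEntry hN hn 0)

/-- The word `0^{k₁ - 1} 1 ⋯ 0^{k_r - 1} 1` of a composition. -/
def compWord (K : List ℕ) : List Bool :=
  K.flatMap fun k => List.replicate (k - 1) false ++ [true]

theorem compWord_cons (k : ℕ) (K : List ℕ) :
    compWord (k :: K) = List.replicate (k - 1) false ++ true :: compWord K := by
  simp [compWord]

theorem lintegral_rpow_Ioo {x p : ℝ} (hx : 0 < x) (hp : 0 < p) :
    ∫⁻ t in Ioo 0 x, ENNReal.ofReal (t ^ (p - 1)) = ENNReal.ofReal (x ^ p / p) := by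
  have hi : IntervalIntegrable (fun t : ℝ => t ^ (p - 1)) volume 0 x :=
    intervalIntegral.intervalIntegrable_rpow' (by linarith)
  have hi' : IntegrableOn (fun t : ℝ => t ^ (p - 1)) (Ioo 0 x) :=
    ((intervalIntegrable_iff_integrableOn_Ioc_of_le hx.le).1 hi).mono_set Ioo_subset_Ioc_self
  rw [← ofReal_integral_eq_lintegral_ofReal hi'
    ((ae_restrict_mem measurableSet_Ioo).mono fun t ht => Real.rpow_nonneg ht.1.le _),
    ← integral_Ioc_eq_integral_Ioo, ← intervalIntegral.integral_of_le hx.le,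
    integral_rpow (Or.inl (by linarith))]
  simp [hp.ne']

theorem lintegral_const_mul_rpow_Ioo {x p c : ℝ} (hx : 0 < x) (hp : 0 < p) (hc : 0 ≤ c) :
    ∫⁻ t in Ioo 0 x, ENNReal.ofReal (c * t ^ (p - 1)) = ENNReal.ofReal (c * x ^ p / p) := by
  simp_rw [ENNReal.ofReal_mul hc]
  rw [lintegral_const_mul _ (by fun_prop), lintegral_rpow_Ioo hx hp, mul_div_assoc,
    ENNReal.ofReal_mul hc]

/-- Iterated integration of a generalized power series against `dt / t`. -/
theorem iterInt_replicate_false_append {ι : Type*} [Countable ι] {N : ℕ} {g : ℝ → ℝ≥0∞}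
    {v : List Bool} {c p : ι → ℝ} (hc : ∀ i, 0 ≤ c i) (hp : ∀ i, 0 < p i)
    (h : ∀ x ∈ Ioc (0 : ℝ) 1, iterInt N g v x = ∑' i, ENNReal.ofReal (c i * x ^ p i))
    (m : ℕ) : ∀ x ∈ Ioc (0 : ℝ) 1,
      iterInt N g (List.replicate m false ++ v) x
        = ∑' i, ENNReal.ofReal (c i / p i ^ m * x ^ p i) := by
  induction m with
  | zero => simpa using h
  | succ m ih =>
    intro x hx
    have h1 : ∀ t ∈ Ioo (0 : ℝ) x, iterInt N g (List.replicate m false ++ v) t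
        * ENNReal.ofReal (formDensity N false t)
        = ∑' i, ENNReal.ofReal (c i / p i ^ m * t ^ (p i - 1)) := by
      intro t ht
      rw [ih t ⟨ht.1, ht.2.le.trans hx.2⟩, ← ENNReal.tsum_mul_right]
      refine tsum_congr fun i => ?_
      have := Real.rpow_nonneg ht.1.le (p i)
      rw [← ENNReal.ofReal_mul
        (mul_nonneg (div_nonneg (hc i) (pow_nonneg (hp i).le _)) this)]
      simp only [formDensity]
      rw [Real.rpow_sub_one ht.1.ne']
      congr 1
      ring
    simp only [List.replicate_succ, List.cons_append, iterInt]
    rw [setLIntegral_congr_fun measurableSet_Ioo h1, lintegral_tsum fun i => by fun_prop]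
    refine tsum_congr fun i => ?_
    rw [lintegral_const_mul_rpow_Ioo hx.1 (hp i) (div_nonneg (hc i) (pow_nonneg (hp i).le _))]
    congr 1
    have := (hp i).ne'
    rw [pow_succ]
    field_simp

/-- This is where N is limited to 1 and 2: only then is (1 - t)(1 + (N - 1)t) equal to 1 - t^N. -/
theorem hasSum_formDensity_true {N : ℕ} (hN : N = 1 ∨ N = 2) {t : ℝ} (ht : t ∈ Ioo (0 : ℝ) 1) :
    HasSum (fun e : ℕ => (N : ℝ) * t ^ (N * e)) (formDensity N true t) := by
  have h1 : t ^ N < 1 := pow_lt_one₀ ht.1.le ht.2 (by omega)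
  have h2 : formDensity N true t = N * (1 - t ^ N)⁻¹ := by
    rcases hN with rfl | rfl
    · simp [formDensity]
    · simp only [formDensity, Nat.cast_ofNat]
      rw [div_eq_mul_inv]
      congr 2
      ring
  rw [h2]
  simp_rw [pow_mul]
  exact (hasSum_geometric_of_lt_one (pow_nonneg ht.1.le N) h1).mul_left (N : ℝ)

/-- Integration of a generalized power series against the second one-form. -/
theorem iterInt_true_cons {ι : Type*} [Countable ι] {N : ℕ} (hN : N = 1 ∨ N = 2)
    {g : ℝ → ℝ≥0∞} {v : List Bool} {c p : ι → ℝ} (hc : ∀ i, 0 ≤ c i) (hp : ∀ i, -1 < p i)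
    (h : ∀ x ∈ Ioc (0 : ℝ) 1, iterInt N g v x = ∑' i, ENNReal.ofReal (c i * x ^ p i)) :
    ∀ x ∈ Ioc (0 : ℝ) 1, iterInt N g (true :: v) x
      = ∑' q : ι × ℕ, ENNReal.ofReal
          (N * c q.1 / (p q.1 + N * q.2 + 1) * x ^ (p q.1 + N * q.2 + 1)) := by
  intro x hx
  have h1 : ∀ t ∈ Ioo (0 : ℝ) x, iterInt N g v t * ENNReal.ofReal (formDensity N true t)
      = ∑' q : ι × ℕ, ENNReal.ofReal (N * c q.1 * t ^ ((p q.1 + N * q.2 + 1) - 1)) := by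
    intro t ht
    have hs := hasSum_formDensity_true hN (t := t) ⟨ht.1, ht.2.trans_le hx.2⟩
    rw [h t ⟨ht.1, ht.2.le.trans hx.2⟩, ← hs.tsum_eq,
      ENNReal.ofReal_tsum_of_nonneg (fun e => by have := ht.1; positivity) hs.summable,
      ENNReal.tsum_prod', ← ENNReal.tsum_mul_right]
    refine tsum_congr fun i => ?_
    rw [← ENNReal.tsum_mul_left]
    refine tsum_congr fun e => ?_
    rw [← ENNReal.ofReal_mul (mul_nonneg (hc i) (Real.rpow_nonneg ht.1.le _))]
    congr 1
    rw [add_sub_cancel_right, Real.rpow_add ht.1, ← Nat.cast_mul, Real.rpow_natCast]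
    ring
  simp only [iterInt]
  rw [setLIntegral_congr_fun measurableSet_Ioo h1, lintegral_tsum fun i => by fun_prop]
  refine tsum_congr fun q => ?_
  have hp' : 0 < p q.1 + N * q.2 + 1 := by
    have := hp q.1
    have : (0 : ℝ) ≤ N * q.2 := by positivity
    linarith
  rw [lintegral_const_mul_rpow_Ioo hx.1 hp' (mul_nonneg (Nat.cast_nonneg _) (hc _))]
  congr 1
  ring

theorem prod_levelEntry_decTuplesCons (N : ℕ) {r : ℕ} (K : Fin (r + 1) → ℕ) (α : ℝ)
    (q : decTuples r × ℕ) :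
    ∏ i, (levelEntry N (decTuplesCons r q).1 i - α) ^ K i
      = (levelFirst N q.1.1 - α + N * q.2 + 1) ^ K 0
        * ∏ i, (levelEntry N q.1.1 i - α) ^ K i.succ := by
  rw [Fin.prod_univ_succ]
  simp only [decTuplesCons, Equiv.coe_fn_mk, levelEntry_cons_succ, levelEntry_cons_zero]
  congr 2
  ring

theorem levelFirst_decTuplesCons (N : ℕ) {r : ℕ} (q : decTuples r × ℕ) :
    levelFirst N (decTuplesCons r q).1 = levelFirst N q.1.1 + N * q.2 + 1 := by
  rw [levelFirst_succ]
  simp only [decTuplesCons, Equiv.coe_fn_mk, levelEntry_cons_zero]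

/-- The series expansion of the iterated integrals with initial function `t ^ (-α)`. -/
theorem iterInt_compWord {N : ℕ} (hN : N = 1 ∨ N = 2) {α : ℝ} (hα : α < 1) {r : ℕ}
    (K : Fin r → ℕ) (hK : ∀ i, 0 < K i) : ∀ x ∈ Ioc (0 : ℝ) 1,
      iterInt N (fun t => ENNReal.ofReal (t ^ (-α))) (compWord (List.ofFn K)) x
        = ∑' n : decTuples r, ENNReal.ofReal
            ((N : ℝ) ^ r / (∏ i, (levelEntry N n.1 i - α) ^ K i)
              * x ^ (levelFirst N n.1 - α)) := by
  have hN1 : 1 ≤ N := by omega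
  induction r with
  | zero =>
    intro x hx
    have : Unique (decTuples 0) :=
      ⟨⟨⟨fun i => i.elim0, ⟨fun i => i.elim0, fun i => i.elim0⟩⟩⟩,
        fun a => Subtype.ext (funext fun i => i.elim0)⟩
    rw [tsum_eq_single default fun b hb => (hb (Subsingleton.elim _ _)).elim]
    simp [compWord, iterInt, levelFirst, firstEntry]
  | succ r ih =>
    have ih' := ih (fun i => K i.succ) fun i => hK i.succ
    have hpos : ∀ n : decTuples r, ∀ i, 0 < levelEntry N n.1 i - α := fun n i => by
      linarith [one_le_levelEntry hN1 n.2 i]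
    have hc : ∀ n : decTuples r,
        0 ≤ (N : ℝ) ^ r / ∏ i, (levelEntry N n.1 i - α) ^ K i.succ := fun n =>
      div_nonneg (by positivity) (Finset.prod_nonneg fun i _ => pow_nonneg (hpos n i).le _)
    have hp : ∀ n : decTuples r, -1 < levelFirst N n.1 - α := fun n => by
      linarith [levelFirst_nonneg hN1 n.2]
    have hp2 : ∀ q : decTuples r × ℕ, 0 < levelFirst N q.1.1 - α + N * q.2 + 1 :=
      fun q => by
        have : (0 : ℝ) ≤ N * q.2 := by positivity
        linarith [hp q.1]
    intro x hx
    have hc2 : ∀ q : decTuples r × ℕ, 0 ≤ N * ((N : ℝ) ^ r /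
        ∏ i, (levelEntry N q.1.1 i - α) ^ K i.succ) / (levelFirst N q.1.1 - α + N * q.2 + 1) :=
      fun q => div_nonneg (mul_nonneg (Nat.cast_nonneg _) (hc q.1)) (hp2 q).le
    -- The letter `true` is integrated first: it needs only exponents above -1, as with t^{-α}, and
    -- leaves positive exponents, which the letters `false` require. The geometric index is the jump
    -- parameter of `decTuplesCons`.
    have h1 := iterInt_true_cons hN hc hp ih'
    have h2 := iterInt_replicate_false_append hc2 hp2 h1 (K 0 - 1) x hx
    rw [List.ofFn_succ, compWord_cons, h2, ← Equiv.tsum_eq (decTuplesCons r)]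
    refine tsum_congr fun q => ?_
    rw [prod_levelEntry_decTuplesCons, levelFirst_decTuplesCons]
    obtain ⟨k, hk⟩ := Nat.exists_eq_add_of_lt (hK 0)
    have h3 := (hp2 q).ne'
    have h4 : (∏ i, (levelEntry N q.1.1 i - α) ^ K i.succ) ≠ 0 :=
      (Finset.prod_pos fun i _ => pow_pos (hpos q.1 i) _).ne'
    rw [hk, show 0 + k + 1 - 1 = k by omega, zero_add, pow_succ, pow_succ,
      show levelFirst N q.1.1 + N * q.2 + 1 - α = levelFirst N q.1.1 - α + N * q.2 + 1 by ring]
    congr 2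
    generalize (∏ i, (levelEntry N q.1.1 i - α) ^ K i.succ) = P at h4 ⊢
    generalize levelFirst N q.1.1 - α + N * q.2 + 1 = Q at h3 ⊢
    field_simp

/-! ### Words of compositions and the Hoffman dual -/

theorem length_compWord (K : List ℕ) (hK : ∀ k ∈ K, 0 < k) : (compWord K).length = K.sum := by
  induction K with
  | nil => rfl
  | cons k K ih =>
    have h1 := ih fun k hk => hK k (List.mem_cons_of_mem _ hk)
    have h2 := hK k List.mem_cons_self
    rw [compWord_cons, List.length_append, List.length_cons, h1, List.length_replicate,
      List.sum_cons]
    omega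

theorem count_true_compWord (K : List ℕ) : (compWord K).count true = K.length := by
  induction K with
  | nil => rfl
  | cons k K ih =>
    rw [compWord_cons, List.count_append, List.count_cons, ih, List.length_cons,
      List.count_replicate]
    simp

theorem compWord_append (K L : List ℕ) : compWord (K ++ L) = compWord K ++ compWord L := by
  simp [compWord]

/-- With an extra 1 in front the word is 1 0^{k₁-1} 1 ⋯ 0^{k_r-1} 1, whose blocks of zeros are
enclosed by ones on both sides, so reversal just reverses the blocks. -/
theorem cons_compWord_reverse (K : List ℕ) :
    true :: compWord K.reverse = (true :: compWord K).reverse := by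
  induction K with
  | nil => rfl
  | cons k K ih =>
    rw [List.reverse_cons, compWord_append, ← List.cons_append, ih]
    simp [compWord]

/-- Each block of length k ends in its only 1, so ones mark partial sums. Positions count from 0,
hence the shift by one, which also excludes the empty partial sum. -/
theorem compWord_getElem?_eq_true_iff (K : List ℕ) (hK : ∀ k ∈ K, 0 < k) (p : ℕ) :
    (compWord K)[p]? = some true ↔ ∃ j, (K.take j).sum = p + 1 := by
  induction K generalizing p with
  | nil => simp [compWord]
  | cons k K ih =>
    have ih' := ih fun k hk => hK k (List.mem_cons_of_mem _ hk)
    have h2 := hK k List.mem_cons_self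
    have h3 : (∃ j, ((k :: K).take j).sum = p + 1) ↔ ∃ j, k + (K.take j).sum = p + 1 := by
      constructor
      · rintro ⟨j, hj⟩
        cases j with
        | zero => simp at hj
        | succ j => exact ⟨j, by simpa using hj⟩
      · rintro ⟨j, hj⟩
        exact ⟨j + 1, by simpa using hj⟩
    rw [h3, compWord_cons]
    rcases lt_trichotomy p (k - 1) with h | h | h
    · rw [List.getElem?_append_left (by simpa using h), List.getElem?_replicate_of_lt h]
      simp only [Option.some.injEq, Bool.false_eq_true, false_iff, not_exists]
      intro j
      omega
    · rw [List.getElem?_append_right (by simp [h])]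
      simp only [List.length_replicate, h, Nat.sub_self, List.getElem?_cons_zero, true_iff]
      exact ⟨0, by simp; omega⟩
    · rw [List.getElem?_append_right (by simp; omega)]
      obtain ⟨d, rfl⟩ := Nat.exists_eq_add_of_lt h
      have h4 : k - 1 + d + 1 - (List.replicate (k - 1) false).length = d + 1 := by
        simp
        omega
      rw [h4, List.getElem?_cons_succ, ih']
      exact exists_congr fun j => by omega

theorem mem_boundaries_iff_exists_sum_take {w : ℕ} (c : Composition w) (p : Fin (w + 1)) :
    p ∈ c.boundaries ↔ ∃ j, (c.blocks.take j).sum = p := by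
  simp only [Composition.boundaries, Finset.mem_map, Finset.mem_univ, true_and,
    RelEmbedding.coe_toEmbedding, Composition.boundary, OrderEmbedding.coe_ofStrictMono]
  constructor
  · rintro ⟨i, hi⟩
    exact ⟨i, congrArg Fin.val hi⟩
  · rintro ⟨j, hj⟩
    refine ⟨⟨min j c.length, by omega⟩, Fin.ext ?_⟩
    simp only [Composition.sizeUpTo]
    rw [← hj]
    rcases le_total j c.length with h | h
    · rw [min_eq_left h]
    · rw [min_eq_right h, List.take_of_length_le h]
      simp

theorem compWord_blocks_getElem?_eq_true_iff {w : ℕ} (c : Composition w) {p : ℕ} (hp : p < w) :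
    (compWord c.blocks)[p]? = some true ↔ (⟨p + 1, by omega⟩ : Fin (w + 1)) ∈ c.boundaries := by
  rw [compWord_getElem?_eq_true_iff _ fun k hk => c.blocks_pos hk,
    mem_boundaries_iff_exists_sum_take]

theorem length_compWord_blocks {w : ℕ} (c : Composition w) : (compWord c.blocks).length = w := by
  rw [length_compWord _ fun k hk => c.blocks_pos hk, c.blocks_sum]

theorem mem_boundaries_hoffmanDual {w : ℕ} (c : Composition w) (p : Fin (w + 1)) :
    p ∈ (hoffmanDual c).boundaries ↔ p = 0 ∨ p = Fin.last w ∨ p ∉ c.boundaries := by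
  rw [hoffmanDual, CompositionAsSet.toComposition_boundaries]
  exact Finset.mem_filter.trans (and_iff_right (Finset.mem_univ p))

theorem last_mem_boundaries {w : ℕ} (c : Composition w) : Fin.last w ∈ c.boundaries :=
  (mem_boundaries_iff_exists_sum_take c _).2 ⟨c.length, by simp [c.blocks_sum]⟩

theorem getElem_eq_of_iff_true {l l' : List Bool} (h : l.length = l'.length)
    (hl : ∀ p < l.length, l[p]? = some true ↔ l'[p]? = some true) : l = l' := by
  refine List.ext_getElem h fun p h1 h2 => ?_
  have := hl p h1
  rw [List.getElem?_eq_getElem h1, List.getElem?_eq_getElem h2, Option.some_inj,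
    Option.some_inj] at this
  exact Bool.eq_iff_iff.2 this

/-- The word of a composition ends in `1`; the remaining letters are complemented by duality. -/
theorem exists_compWord_hoffmanDual {w : ℕ} (hw : 0 < w) (c : Composition w) :
    ∃ u : List Bool, compWord c.blocks = u ++ [true] ∧
      compWord (hoffmanDual c).blocks = u.map not ++ [true] := by
  have hlen := length_compWord_blocks c
  have hne : compWord c.blocks ≠ [] := by
    rintro h
    simp [h] at hlen
    omega
  obtain ⟨u, b, hub⟩ : ∃ u b, compWord c.blocks = u ++ [b] :=
    ⟨_, _, (List.dropLast_append_getLast hne).symm⟩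
  have hu : u.length + 1 = w := by
    rw [hub] at hlen
    simpa using hlen
  -- The last letter corresponds to the partial sum `w`, which is a boundary of every composition.
  have hb : b = true := by
    have := (compWord_blocks_getElem?_eq_true_iff c (p := u.length) (by omega)).2
      (by convert last_mem_boundaries c; simp [hu])
    rw [hub] at this
    simpa using this
  subst hb
  refine ⟨u, hub, getElem_eq_of_iff_true ?_ fun p hp => ?_⟩
  · rw [length_compWord_blocks]
    simp [hu]
  · rw [length_compWord_blocks] at hp
    rw [compWord_blocks_getElem?_eq_true_iff _ hp, mem_boundaries_hoffmanDual,
      ← compWord_blocks_getElem?_eq_true_iff _ hp, hub]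
    rcases Nat.lt_or_ge p u.length with h | h
    · rw [List.getElem?_append_left h, List.getElem?_append_left (by simpa using h),
        List.getElem?_eq_getElem h, List.getElem?_map, List.getElem?_eq_getElem h]
      simp [Fin.ext_iff]
      omega
    · have : p = u.length := by omega
      subst this
      simp [Fin.ext_iff, hu, List.getElem?_append_right]

theorem length_hoffmanDual_pos {w : ℕ} (hw : 0 < w) (c : Composition w) :
    0 < (hoffmanDual c).length :=
  Composition.length_pos_of_pos _ hw

theorem compWord_raiseFirst {r : ℕ} (hr : 0 < r) (k : Fin r → ℕ) (hk : ∀ i, 0 < k i) :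
    compWord (List.ofFn (raiseFirst k)) = false :: compWord (List.ofFn k) := by
  cases r with
  | zero => omega
  | succ r =>
    obtain ⟨d, hd⟩ := Nat.exists_eq_add_of_lt (hk 0)
    have : (fun i : Fin r => raiseFirst k i.succ) = fun i => k i.succ := by
      ext i
      simp [raiseFirst]
    rw [List.ofFn_succ, List.ofFn_succ, compWord_cons, compWord_cons, this]
    simp [raiseFirst, hd, List.replicate_succ]

/-- If u 1 is the word of k̄, then 1 u is the reversed word of k by `cons_compWord_reverse`.
Complementing gives 0 ū, where ū 1 is the word of k̄^∨; the leading 0 is precisely the raised first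
exponent. -/
theorem compWord_dualExponents {w : ℕ} (hw : 0 < w) (c : Composition w) :
    compWord (List.ofFn (dualExponents c))
      = ((compWord (List.ofFn c.blocksFun)).map not).reverse ++ [true] := by
  rw [dualExponents, compWord_raiseFirst (length_hoffmanDual_pos hw _)
    _ (fun i => Composition.one_le_blocksFun _ i), Composition.ofFn_blocksFun,
    Composition.ofFn_blocksFun]
  obtain ⟨u, h1, h2⟩ := exists_compWord_hoffmanDual hw c.reverse
  have h3 := cons_compWord_reverse c.blocks
  have h4 : c.reverse.blocks = c.blocks.reverse := rfl
  rw [h4] at h1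
  rw [h1, List.reverse_cons, ← List.cons_append] at h3
  have h5 := List.append_inj_left' h3 rfl
  rw [h2, ← List.map_reverse, ← h5]
  simp

/-- Depth is the number of ones. Those of u and of its complement add up to w - 1, and each word has
one further final 1. -/
theorem length_hoffmanDual_reverse {w : ℕ} (hw : 0 < w) (c : Composition w) :
    (hoffmanDual c.reverse).length = w + 1 - c.length := by
  obtain ⟨u, h1, h2⟩ := exists_compWord_hoffmanDual hw c.reverse
  have e1 := congrArg (List.count true) h1
  have e2 := congrArg (List.count true) h2
  have e3 := congrArg List.length h1
  have hl : c.reverse.blocks.length = c.length := by simp [Composition.reverse]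
  have e4 : ∀ l : List Bool, (l.map not).count true + l.count true = l.length := fun l => by
    induction l with
    | nil => rfl
    | cons b l ih => cases b <;> simp at ih ⊢ <;> omega
  rw [count_true_compWord] at e1 e2
  rw [length_compWord_blocks] at e3
  have := e4 u
  simp only [List.count_append, List.count_singleton_self, List.length_append,
    List.length_singleton] at e1 e2 e3
  change (hoffmanDual c.reverse).length = _ at e2
  omega

theorem dualExponents_pos {w : ℕ} (c : Composition w) (i) : 0 < dualExponents c i := by
  have := Composition.one_le_blocksFun (hoffmanDual c.reverse) i
  unfold dualExponents raiseFirst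
  split <;> omega

theorem two_le_dualExponents {w : ℕ} (c : Composition w)
    (i : Fin (hoffmanDual c.reverse).length) (hi : (i : ℕ) = 0) : 2 ≤ dualExponents c i := by
  have := Composition.one_le_blocksFun (hoffmanDual c.reverse) i
  unfold dualExponents raiseFirst
  rw [if_pos hi]
  omega

/-! ### Convergence and holomorphy of the Hurwitz-type series -/

theorem summable_pi_prod {f : ℕ → ℝ} (hf : Summable f) (h0 : ∀ n, 0 ≤ f n) (r : ℕ) :
    Summable fun n : Fin r → ℕ => ∏ i, f (n i) := by
  induction r with
  | zero => exact Summable.of_finite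
  | succ r ih =>
    rw [← (Fin.consEquiv fun _ : Fin (r + 1) => ℕ).summable_iff]
    have := hf.mul_of_nonneg ih h0 fun n => Finset.prod_nonneg fun i _ => h0 _
    refine this.congr fun q => ?_
    simp [Fin.prod_univ_succ, Fin.consEquiv]

/-- The summable majorant `∏ nᵢ ^ (-(1 + 1 / r))` of multiple zeta series. -/
def tupleMajorant (r : ℕ) (n : decTuples r) : ℝ := ∏ i, (n.1 i : ℝ) ^ (-(1 + 1 / (r : ℝ)))

theorem summable_tupleMajorant {r : ℕ} (hr : 0 < r) : Summable (tupleMajorant r) := by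
  have hr' : (0 : ℝ) < 1 / r := by positivity
  exact (summable_pi_prod (Real.summable_nat_rpow.2 (by linarith))
    (fun n => Real.rpow_nonneg (Nat.cast_nonneg n) _) r).comp_injective Subtype.val_injective

/-- The spare factor n₁ is shared out evenly: since n₁ is the largest entry, n₁ ≥ ∏ nᵢ^{1/r}, so n₁²
n₂ ⋯ n_r ≥ ∏ nᵢ^{1 + 1/r}. -/
theorem inv_prod_pow_le_tupleMajorant {r : ℕ} (hr : 0 < r) {K : Fin r → ℕ} (hK : ∀ i, 0 < K i)
    (hK0 : ∀ i : Fin r, (i : ℕ) = 0 → 2 ≤ K i) (n : decTuples r) :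
    (∏ i, (n.1 i : ℝ) ^ K i)⁻¹ ≤ tupleMajorant r n := by
  obtain ⟨s, rfl⟩ : ∃ s, r = s + 1 := ⟨r - 1, by omega⟩
  have hn : ∀ i, (1 : ℝ) ≤ n.1 i := fun i => by exact_mod_cast n.2.2 i
  have hpos : ∀ i, (0 : ℝ) < n.1 i := fun i => zero_lt_one.trans_le (hn i)
  have h1 : (n.1 0 : ℝ) * ∏ i, (n.1 i : ℝ) ≤ ∏ i, (n.1 i : ℝ) ^ K i := by
    rw [Fin.prod_univ_succ, Fin.prod_univ_succ, ← mul_assoc, ← pow_two]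
    refine mul_le_mul (pow_le_pow_right₀ (hn 0) (hK0 0 rfl)) ?_
      (Finset.prod_nonneg fun i _ => (hpos _).le) (pow_nonneg (hpos 0).le _)
    refine Finset.prod_le_prod (fun i _ => (hpos _).le) fun i _ => ?_
    exact le_self_pow₀ (hn _) (hK i.succ).ne'
  have h2 : ∏ i, (n.1 i : ℝ) ^ (1 / ((s + 1 : ℕ) : ℝ)) ≤ n.1 0 := by
    calc ∏ i, (n.1 i : ℝ) ^ (1 / ((s + 1 : ℕ) : ℝ))
        ≤ ∏ _i : Fin (s + 1), (n.1 0 : ℝ) ^ (1 / ((s + 1 : ℕ) : ℝ)) := by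
          refine Finset.prod_le_prod (fun i _ => Real.rpow_nonneg (hpos i).le _) fun i _ => ?_
          refine Real.rpow_le_rpow (hpos i).le ?_ (by positivity)
          exact_mod_cast n.2.1.antitone (Fin.zero_le i)
      _ = n.1 0 := by
          rw [Finset.prod_const, Finset.card_univ, Fintype.card_fin, ← Real.rpow_natCast,
            ← Real.rpow_mul (hpos 0).le, one_div, inv_mul_cancel₀ (by positivity), Real.rpow_one]
  have h3 : tupleMajorant (s + 1) n
      = ((∏ i, (n.1 i : ℝ) ^ (1 / ((s + 1 : ℕ) : ℝ))) * ∏ i, (n.1 i : ℝ))⁻¹ := by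
    rw [tupleMajorant, ← Finset.prod_mul_distrib, ← Finset.prod_inv_distrib]
    refine Finset.prod_congr rfl fun i _ => ?_
    rw [Real.rpow_neg (hpos i).le, Real.rpow_add (hpos i), Real.rpow_one, mul_comm]
  rw [h3]
  have h4 : 0 < ∏ i, (n.1 i : ℝ) := Finset.prod_pos fun i _ => hpos i
  exact inv_anti₀ (mul_pos (Finset.prod_pos fun i _ => Real.rpow_pos_of_pos (hpos i) _) h4)
    ((mul_le_mul_of_nonneg_right h2 h4.le).trans h1)

theorem isOpen_complexMinusPosNat : IsOpen complexMinusPosNat := by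
  have h : complexMinusPosNat = (((↑) : ℤ → ℂ) '' {n | 0 < n})ᶜ := by
    ext α
    simp only [complexMinusPosNat, mem_ofPred_eq, mem_compl_iff, mem_image, not_exists, not_and]
    constructor
    · rintro h n hn rfl
      lift n to ℕ using hn.le
      exact h n (by exact_mod_cast hn) (by simp)
    · rintro h n hn rfl
      exact h n (by exact_mod_cast hn) (by simp)
  rw [h]
  exact (Complex.isClosedEmbedding_intCast.isClosedMap _ (isClosed_discrete _)).isOpen_compl

/-- Near a point of `complexMinusPosNat` the distance to `q` is at least a multiple of `q`. -/
theorem exists_ball_natCast_le_mul_norm {z : ℂ} (hz : z ∈ complexMinusPosNat) :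
    ∃ ε > 0, ∃ C : ℝ, 1 ≤ C ∧ Metric.ball z ε ⊆ complexMinusPosNat ∧
      ∀ α ∈ Metric.ball z ε, ∀ q : ℕ, 0 < q → (q : ℝ) ≤ C * ‖(q : ℂ) - α‖ := by
  obtain ⟨ε, hε, hball⟩ := Metric.isOpen_iff.1 isOpen_complexMinusPosNat z hz
  have hε2 : 0 < ε / 2 := by positivity
  have hR : 0 ≤ (‖z‖ + ε / 2) / (ε / 2) := by positivity
  -- Halving the radius keeps α at distance at least ε/2 from each q. The constant then comes from q
  -- ≤ |q - α| + |α| with |α| ≤ |z| + ε/2.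
  refine ⟨ε / 2, hε2, 1 + (‖z‖ + ε / 2) / (ε / 2), by linarith,
    (Metric.ball_subset_ball (by linarith)).trans hball, fun α hα q hq => ?_⟩
  have h1 : ε / 2 ≤ ‖(q : ℂ) - α‖ := by
    by_contra! hlt
    refine hball (a := (q : ℂ)) ?_ q hq rfl
    rw [Metric.mem_ball, dist_eq_norm] at hα ⊢
    calc ‖(q : ℂ) - z‖ = ‖((q : ℂ) - α) + (α - z)‖ := by ring_nf
      _ ≤ ‖(q : ℂ) - α‖ + ‖α - z‖ := norm_add_le _ _
      _ < ε := by linarith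
  have h2 : ‖α‖ ≤ ‖z‖ + ε / 2 := by
    rw [Metric.mem_ball, dist_eq_norm] at hα
    calc ‖α‖ = ‖z + (α - z)‖ := by ring_nf
      _ ≤ ‖z‖ + ‖α - z‖ := norm_add_le _ _
      _ ≤ _ := by linarith
  have h3 : (q : ℝ) ≤ ‖(q : ℂ) - α‖ + ‖α‖ := by
    calc (q : ℝ) = ‖((q : ℂ) - α) + α‖ := by simp
      _ ≤ _ := norm_add_le _ _
  have h4 : ‖z‖ + ε / 2 ≤ (‖z‖ + ε / 2) / (ε / 2) * ‖(q : ℂ) - α‖ := by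
    calc ‖z‖ + ε / 2 = (‖z‖ + ε / 2) / (ε / 2) * (ε / 2) := by field_simp
      _ ≤ _ := mul_le_mul_of_nonneg_left h1 hR
  linarith

/-- The general term of the level `N` Hurwitz-type series. -/
def levelTerm (N : ℕ) {r : ℕ} (K : Fin r → ℕ) (α : ℂ) (n : decTuples r) : ℂ :=
  (N : ℂ) ^ r / ∏ i, (((levelEntry N n.1 i : ℝ) : ℂ) - α) ^ K i

theorem levelEntry_sub_ne_zero {N : ℕ} (hN : 1 ≤ N) {r : ℕ} (n : decTuples r) {α : ℂ}
    (hα : α ∈ complexMinusPosNat) (i : Fin r) : ((levelEntry N n.1 i : ℝ) : ℂ) - α ≠ 0 := by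
  obtain ⟨q, hq, h⟩ := exists_levelEntry_eq hN n.2 i
  rw [h, sub_ne_zero, Complex.ofReal_natCast]
  exact (hα q ((n.2.2 i).trans_le hq)).symm

/-- Each denominator is a natural number q ≥ nᵢ, so replacing |q - α| by nᵢ costs at most a factor
C. The bound depends on α only through C, hence is locally uniform. -/
theorem norm_levelTerm_le {N : ℕ} (hN : 1 ≤ N) {r : ℕ} (hr : 0 < r) {K : Fin r → ℕ}
    (hK : ∀ i, 0 < K i) (hK0 : ∀ i : Fin r, (i : ℕ) = 0 → 2 ≤ K i) {C : ℝ} (hC : 1 ≤ C) {α : ℂ}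
    (hα : α ∈ complexMinusPosNat)
    (h : ∀ q : ℕ, 0 < q → (q : ℝ) ≤ C * ‖(q : ℂ) - α‖) (n : decTuples r) :
    ‖levelTerm N K α n‖ ≤ (N : ℝ) ^ r * (∏ i, C ^ K i) * tupleMajorant r n := by
  have hpos : ∀ i, (0 : ℝ) < n.1 i := fun i => by exact_mod_cast n.2.2 i
  have h0 : ∀ i, 0 < ‖((levelEntry N n.1 i : ℝ) : ℂ) - α‖ := fun i =>
    norm_pos_iff.2 (levelEntry_sub_ne_zero hN n hα i)
  have h1 : ∏ i, (n.1 i : ℝ) ^ K i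
      ≤ (∏ i, C ^ K i) * ∏ i, ‖((levelEntry N n.1 i : ℝ) : ℂ) - α‖ ^ K i := by
    rw [← Finset.prod_mul_distrib]
    refine Finset.prod_le_prod (fun i _ => (pow_pos (hpos i) _).le) fun i _ => ?_
    rw [← mul_pow]
    refine pow_le_pow_left₀ (hpos i).le ?_ _
    obtain ⟨q, hq, hqe⟩ := exists_levelEntry_eq hN n.2 i
    rw [hqe, Complex.ofReal_natCast]
    exact le_trans (by exact_mod_cast hq) (h q ((n.2.2 i).trans_le hq))
  have hP : 0 < ∏ i, (n.1 i : ℝ) ^ K i := Finset.prod_pos fun i _ => pow_pos (hpos i) _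
  have hQ : 0 < ∏ i, ‖((levelEntry N n.1 i : ℝ) : ℂ) - α‖ ^ K i :=
    Finset.prod_pos fun i _ => pow_pos (h0 i) _
  rw [levelTerm, norm_div, norm_pow, Complex.norm_natCast, norm_prod]
  simp_rw [norm_pow]
  rw [div_eq_mul_inv, mul_assoc]
  refine mul_le_mul_of_nonneg_left ?_ (by positivity)
  refine le_trans ?_ (mul_le_mul_of_nonneg_left (inv_prod_pow_le_tupleMajorant hr hK hK0 n)
    (Finset.prod_nonneg fun i _ => by positivity))
  rw [← div_eq_mul_inv, inv_eq_one_div, div_le_div_iff₀ hQ hP, one_mul]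
  exact h1

theorem summable_levelTerm {N : ℕ} (hN : 1 ≤ N) {r : ℕ} (hr : 0 < r) {K : Fin r → ℕ}
    (hK : ∀ i, 0 < K i) (hK0 : ∀ i : Fin r, (i : ℕ) = 0 → 2 ≤ K i) {α : ℂ}
    (hα : α ∈ complexMinusPosNat) : Summable (levelTerm N K α) := by
  obtain ⟨ε, hε, C, hC, -, h⟩ := exists_ball_natCast_le_mul_norm hα
  exact Summable.of_norm_bounded ((summable_tupleMajorant hr).mul_left _)
    (norm_levelTerm_le hN hr hK hK0 hC hα (h α (Metric.mem_ball_self hε)))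

theorem differentiableOn_levelTerm {N : ℕ} (hN : 1 ≤ N) {r : ℕ} (K : Fin r → ℕ)
    (n : decTuples r) :
    DifferentiableOn ℂ (fun α => levelTerm N K α n) complexMinusPosNat := by
  refine DifferentiableOn.div (differentiableOn_const _) (by fun_prop) fun α hα => ?_
  exact Finset.prod_ne_zero_iff.2 fun i _ => pow_ne_zero _ (levelEntry_sub_ne_zero hN n hα i)

/-! ### Derivatives in α -/

theorem iteratedDeriv_inv_sub_pow (a : ℂ) {k : ℕ} (hk : 0 < k) (m : ℕ) {z : ℂ} (hz : z ≠ a) :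
    iteratedDeriv m (fun z => ((a - z) ^ k)⁻¹) z
      = m.factorial * ((k + m - 1).choose m * ((a - z) ^ (k + m))⁻¹) := by
  induction m generalizing z with
  | zero => simp
  | succ m ih =>
    have hev : iteratedDeriv m (fun z => ((a - z) ^ k)⁻¹) =ᶠ[nhds z]
        fun z => m.factorial * ((k + m - 1).choose m * ((a - z) ^ (k + m))⁻¹) := by
      filter_upwards [isOpen_ne.mem_nhds hz] with w hw using ih hw
    have hne : a - z ≠ 0 := sub_ne_zero.2 hz.symm
    have h1 : HasDerivAt (fun z : ℂ => a - z) (-1) z := by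
      simpa using (hasDerivAt_id z).const_sub a
    have h2 := (((h1.fun_pow (k + m)).fun_inv (pow_ne_zero _ hne)).const_mul
      ((k + m - 1).choose m : ℂ)).const_mul (m.factorial : ℂ)
    rw [iteratedDeriv_succ, hev.deriv_eq, h2.deriv]
    obtain ⟨l, rfl⟩ := Nat.exists_eq_add_of_lt hk
    have h3 : ((l + m + 1).choose (m + 1) : ℂ) * (m + 1) = (l + m + 1) * (l + m).choose m := by
      exact_mod_cast (Nat.add_one_mul_choose_eq (l + m) m).symm
    rw [show 0 + l + 1 + m - 1 = l + m by omega, show 0 + l + 1 + (m + 1) - 1 = l + m + 1 by omega,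
      Nat.factorial_succ]
    rw [show 0 + l + 1 + (m + 1) = l + m + 1 + 1 by omega, show 0 + l + 1 + m = l + m + 1 by omega]
    push_cast
    have h4 : (a - z) ^ (l + m) ≠ 0 := pow_ne_zero _ hne
    rw [pow_succ _ (l + m + 1), pow_succ _ (l + m)]
    field_simp
    linear_combination -(m.factorial : ℂ) * h3

theorem sum_antidiagonalTuple_succ {M : Type*} [AddCommMonoid M] (r m : ℕ)
    (f : (Fin (r + 1) → ℕ) → M) :
    ∑ j ∈ Finset.Nat.antidiagonalTuple (r + 1) m, f j
      = ∑ p ∈ Finset.HasAntidiagonal.antidiagonal m, ∑ j ∈ Finset.Nat.antidiagonalTuple r p.2,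
          f (Fin.cons p.1 j) := by
  rw [Finset.sum_sigma']
  symm
  refine Finset.sum_nbij' (fun q => Fin.cons q.1.1 q.2)
    (fun j => ⟨(j 0, ∑ i, Fin.tail j i), Fin.tail j⟩) ?_ ?_ ?_ ?_ ?_
  · rintro ⟨⟨a, b⟩, j⟩ h
    simp only [Finset.mem_sigma, Finset.HasAntidiagonal.mem_antidiagonal, Finset.Nat.mem_antidiagonalTuple] at h ⊢
    rw [Fin.sum_univ_succ]
    simp [h.1, h.2]
  · intro j h
    simp only [Finset.mem_sigma, Finset.HasAntidiagonal.mem_antidiagonal, Finset.Nat.mem_antidiagonalTuple,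
      and_true] at h ⊢
    rw [← h, Fin.sum_univ_succ]
    rfl
  · rintro ⟨⟨a, b⟩, j⟩ h
    simp only [Finset.mem_sigma, Finset.HasAntidiagonal.mem_antidiagonal, Finset.Nat.mem_antidiagonalTuple] at h
    simp [h.2]
  · intro j h
    simp
  · intro q h
    rfl

theorem contDiffAt_inv_sub_pow (a : ℂ) (k : ℕ) {z : ℂ} (hz : z ≠ a) (m : ℕ) :
    ContDiffAt ℂ m (fun z => ((a - z) ^ k)⁻¹) z :=
  ContDiffAt.inv (by fun_prop) (pow_ne_zero _ (sub_ne_zero.2 hz.symm))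

/-- Leibniz rule, splitting off one factor at a time. A p-th derivative of (a - z)^{-k} carries p!
binom(k + p - 1, p), and these factorials cancel the denominators of binom(m, p). -/
theorem iteratedDeriv_prod_inv_sub_pow {r : ℕ} (a : Fin r → ℂ) (K : Fin r → ℕ)
    (hK : ∀ i, 0 < K i) (m : ℕ) {z : ℂ} (hz : ∀ i, z ≠ a i) :
    iteratedDeriv m (fun z => ∏ i, ((a i - z) ^ K i)⁻¹) z
      = m.factorial * ∑ j ∈ Finset.Nat.antidiagonalTuple r m,
          binomProd K j * ∏ i, ((a i - z) ^ (K i + j i))⁻¹ := by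
  induction r generalizing m with
  | zero =>
    cases m with
    | zero => simp [binomProd]
    | succ m => simp [iteratedDeriv_const]
  | succ r ih =>
    have ih' := ih (fun i => a i.succ) (fun i => K i.succ) (fun i => hK _)
    simp_rw [Fin.prod_univ_succ]
    rw [iteratedDeriv_fun_mul (contDiffAt_inv_sub_pow _ _ (hz 0) _)
      (contDiffAt_prod fun i _ => contDiffAt_inv_sub_pow _ _ (hz _) _),
      ← Finset.Nat.sum_antidiagonal_eq_sum_range_succ (fun p q => (m.choose p : ℂ)
        * iteratedDeriv p (fun z => ((a 0 - z) ^ K 0)⁻¹) z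
        * iteratedDeriv q (fun z => ∏ i : Fin r, ((a i.succ - z) ^ K i.succ)⁻¹) z),
      sum_antidiagonalTuple_succ, Finset.mul_sum]
    refine Finset.sum_congr rfl fun p hp => ?_
    rw [iteratedDeriv_inv_sub_pow _ (hK 0) _ (hz 0), ih' _ (fun i => hz _), Finset.mul_sum, Finset.mul_sum,
      Finset.mul_sum]
    refine Finset.sum_congr rfl fun j _ => ?_
    have hf : (m.choose p.1 : ℂ) * p.1.factorial * p.2.factorial = m.factorial := by
      have := Nat.add_choose_mul_factorial_mul_factorial p.1 p.2
      rw [← Nat.choose_symm_add] at this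
      rw [← Finset.HasAntidiagonal.mem_antidiagonal.1 hp]
      exact_mod_cast this
    have hb : (binomProd K (Fin.cons p.1 j : Fin (r + 1) → ℕ) : ℂ)
        = (K 0 + p.1 - 1).choose p.1 * binomProd (fun i => K i.succ) j := by
      simp [binomProd, Fin.prod_univ_succ]
    rw [hb, ← hf]
    simp only [Fin.cons_zero, Fin.cons_succ]
    ring

theorem iteratedDeriv_levelTerm {N : ℕ} (hN : 1 ≤ N) {r : ℕ} {K : Fin r → ℕ}
    (hK : ∀ i, 0 < K i) (m : ℕ) (n : decTuples r) {z : ℂ} (hz : z ∈ complexMinusPosNat) :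
    iteratedDeriv m (fun α => levelTerm N K α n) z
      = m.factorial * ∑ j ∈ Finset.Nat.antidiagonalTuple r m,
          binomProd K j * levelTerm N (K + j) z n := by
  have h1 : (fun α => levelTerm N K α n) = fun α => (N : ℂ) ^ r *
      ∏ i, ((((levelEntry N n.1 i : ℝ) : ℂ) - α) ^ K i)⁻¹ := by
    ext α
    rw [levelTerm, div_eq_mul_inv, Finset.prod_inv_distrib]
  rw [h1, iteratedDeriv_const_mul_field, iteratedDeriv_prod_inv_sub_pow _ _ hK _
    fun i => (sub_ne_zero.1 (levelEntry_sub_ne_zero hN n hz i)).symm, Finset.mul_sum,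
    Finset.mul_sum, Finset.mul_sum]
  refine Finset.sum_congr rfl fun j _ => ?_
  rw [levelTerm, div_eq_mul_inv, Finset.prod_inv_distrib]
  simp only [Pi.add_apply]
  ring

/-- The sum of the level `N` Hurwitz-type series. -/
def levelSum (N : ℕ) {r : ℕ} (K : Fin r → ℕ) (α : ℂ) : ℂ := ∑' n, levelTerm N K α n

/-- Derivatives are finite combinations of terms with larger exponents, so the same majorant
applies. This normal convergence at every order permits termwise differentiation. -/
theorem exists_bound_iteratedDeriv_levelTerm {N : ℕ} (hN : 1 ≤ N) {r : ℕ} (hr : 0 < r)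
    {K : Fin r → ℕ} (hK : ∀ i, 0 < K i) (hK0 : ∀ i : Fin r, (i : ℕ) = 0 → 2 ≤ K i) (m : ℕ)
    {z : ℂ} (hz : z ∈ complexMinusPosNat) :
    ∃ ε > 0, Metric.ball z ε ⊆ complexMinusPosNat ∧ ∃ u : decTuples r → ℝ, Summable u ∧
      ∀ n, ∀ α ∈ Metric.ball z ε, ‖iteratedDeriv m (fun α => levelTerm N K α n) α‖ ≤ u n := by
  obtain ⟨ε, hε, C, hC, hsub, h⟩ := exists_ball_natCast_le_mul_norm hz
  refine ⟨ε, hε, hsub, fun n => m.factorial * ∑ j ∈ Finset.Nat.antidiagonalTuple r m,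
    binomProd K j * ((N : ℝ) ^ r * (∏ i, C ^ (K + j) i) * tupleMajorant r n), ?_, ?_⟩
  · exact (summable_sum fun j _ => ((summable_tupleMajorant hr).mul_left _).mul_left _).mul_left _
  · intro n α hα
    rw [iteratedDeriv_levelTerm hN hK m n (hsub hα), norm_mul, Complex.norm_natCast]
    refine mul_le_mul_of_nonneg_left ?_ (Nat.cast_nonneg _)
    refine (norm_sum_le _ _).trans (Finset.sum_le_sum fun j _ => ?_)
    rw [norm_mul, Complex.norm_natCast]
    refine mul_le_mul_of_nonneg_left ?_ (Nat.cast_nonneg _)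
    exact norm_levelTerm_le hN hr (fun i => Nat.add_pos_left (hK i) _)
      (fun i hi => (hK0 i hi).trans (Nat.le_add_right _ _)) hC (hsub hα) (h α hα) n

theorem differentiableOn_levelSum {N : ℕ} (hN : 1 ≤ N) {r : ℕ} (hr : 0 < r)
    {K : Fin r → ℕ} (hK : ∀ i, 0 < K i) (hK0 : ∀ i : Fin r, (i : ℕ) = 0 → 2 ≤ K i) :
    DifferentiableOn ℂ (levelSum N K) complexMinusPosNat := by
  intro z hz
  obtain ⟨ε, hε, hsub, u, hu, hb⟩ := exists_bound_iteratedDeriv_levelTerm hN hr hK hK0 0 hz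
  have := Complex.differentiableOn_tsum_of_summable_norm hu
    (fun n => (differentiableOn_levelTerm hN K n).mono hsub) Metric.isOpen_ball
    (by simpa using hb)
  exact (this.differentiableAt (Metric.ball_mem_nhds z hε)).differentiableWithinAt

theorem iteratedDeriv_levelSum_eq_tsum {N : ℕ} (hN : 1 ≤ N) {r : ℕ} (hr : 0 < r)
    {K : Fin r → ℕ} (hK : ∀ i, 0 < K i) (hK0 : ∀ i : Fin r, (i : ℕ) = 0 → 2 ≤ K i) (m : ℕ)
    {z : ℂ} (hz : z ∈ complexMinusPosNat) :
    iteratedDeriv m (levelSum N K) z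
      = ∑' n, iteratedDeriv m (fun α => levelTerm N K α n) z := by
  induction m generalizing z with
  | zero => simp [levelSum]
  | succ m ih =>
    have hev : iteratedDeriv m (levelSum N K) =ᶠ[nhds z]
        fun z => ∑' n, iteratedDeriv m (fun α => levelTerm N K α n) z := by
      filter_upwards [isOpen_complexMinusPosNat.mem_nhds hz] with w hw using ih hw
    obtain ⟨ε, hε, hsub, u, hu, hb⟩ := exists_bound_iteratedDeriv_levelTerm hN hr hK hK0 m hz
    have hd : ∀ n, DifferentiableOn ℂ (iteratedDeriv m fun α => levelTerm N K α n)
        (Metric.ball z ε) := fun n => by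
      have := ((differentiableOn_levelTerm hN K n).analyticOnNhd
        isOpen_complexMinusPosNat).iterated_deriv m
      rw [← iteratedDeriv_eq_iterate] at this
      exact this.differentiableOn.mono hsub
    rw [iteratedDeriv_succ, hev.deriv_eq, ← (Complex.hasSum_deriv_of_summable_norm hu hd
      Metric.isOpen_ball hb (Metric.mem_ball_self hε)).tsum_eq]
    simp_rw [iteratedDeriv_succ]

theorem iteratedDeriv_levelSum {N : ℕ} (hN : 1 ≤ N) {r : ℕ} (hr : 0 < r)
    {K : Fin r → ℕ} (hK : ∀ i, 0 < K i) (hK0 : ∀ i : Fin r, (i : ℕ) = 0 → 2 ≤ K i) (m : ℕ)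
    {z : ℂ} (hz : z ∈ complexMinusPosNat) :
    iteratedDeriv m (levelSum N K) z
      = m.factorial * ∑ j ∈ Finset.Nat.antidiagonalTuple r m,
          binomProd K j * levelSum N (K + j) z := by
  rw [iteratedDeriv_levelSum_eq_tsum hN hr hK hK0 m hz]
  simp_rw [iteratedDeriv_levelTerm hN hK m _ hz]
  rw [tsum_mul_left, Summable.tsum_finsetSum]
  · simp_rw [tsum_mul_left]
    rfl
  · intro j _
    exact (summable_levelTerm hN hr (fun i => Nat.add_pos_left (hK i) _)
      (fun i hi => (hK0 i hi).trans (Nat.le_add_right _ _)) hz).mul_left _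

theorem differentiableOn_iteratedDeriv_levelSum {N : ℕ} (hN : 1 ≤ N) {r : ℕ} (hr : 0 < r)
    {K : Fin r → ℕ} (hK : ∀ i, 0 < K i) (hK0 : ∀ i : Fin r, (i : ℕ) = 0 → 2 ≤ K i) (m : ℕ) :
    DifferentiableOn ℂ (iteratedDeriv m (levelSum N K)) complexMinusPosNat := by
  have := ((differentiableOn_levelSum hN hr hK hK0).analyticOnNhd
    isOpen_complexMinusPosNat).iterated_deriv m
  rw [← iteratedDeriv_eq_iterate] at this
  exact this.differentiableOn

/-! ### The integral as a moment generating function -/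

/-- The level `N` polylogarithm, as an iterated integral. -/
def levelPolylog (N : ℕ) {r : ℕ} (k : Fin r → ℕ) (x : ℝ) : ℝ≥0∞ :=
  iterInt N (fun _ => 1) (compWord (List.ofFn k)) x

theorem measurable_levelPolylog (N : ℕ) {r : ℕ} (k : Fin r → ℕ) :
    Measurable (levelPolylog N k) :=
  measurable_iterInt N measurable_const _

theorem toReal_levelPolylog {N : ℕ} (hN : N = 1 ∨ N = 2) {r : ℕ} {k : Fin r → ℕ}
    (hk : ∀ i, 0 < k i) {x : ℝ} (hx : x ∈ Ioo (0 : ℝ) 1) :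
    (levelPolylog N k x).toReal = ∑' n : decTuples r,
      (N : ℝ) ^ r / (∏ i, levelEntry N n.1 i ^ k i) * x ^ levelFirst N n.1 := by
  have h := iterInt_compWord hN zero_lt_one k hk x ⟨hx.1, hx.2.le⟩
  simp only [neg_zero, Real.rpow_zero, ENNReal.ofReal_one, sub_zero] at h
  rw [levelPolylog, h, ENNReal.tsum_toReal_eq fun _ => ENNReal.ofReal_ne_top]
  refine tsum_congr fun n => ENNReal.toReal_ofReal ?_
  have hN1 : 1 ≤ N := by omega
  exact mul_nonneg (div_nonneg (by positivity) (Finset.prod_nonneg fun i _ =>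
    pow_nonneg (zero_le_one.trans (one_le_levelEntry hN1 n.2 i)) _)) (Real.rpow_nonneg hx.1.le _)

/-- The density of the measure whose moment-generating function is the level `N` series. -/
def polylogDensity (N : ℕ) {r : ℕ} (k : Fin r → ℕ) (x : ℝ) : ℝ≥0∞ :=
  ENNReal.ofReal (1 / x) * levelPolylog N k x

theorem measurable_polylogDensity (N : ℕ) {r : ℕ} (k : Fin r → ℕ) :
    Measurable (polylogDensity N k) :=
  (measurable_formDensity N false).ennreal_ofReal.mul (measurable_levelPolylog N k)

/-- The measure on `(0, 1)` whose moment-generating function is the level `N` series. -/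
def polylogMeasure (N : ℕ) {r : ℕ} (k : Fin r → ℕ) : Measure ℝ :=
  (volume.restrict (Ioo 0 1)).withDensity (polylogDensity N k)

/-- The random variable `-log ((1 - t) / (1 + (N - 1) t))`. -/
def negLogInvol (N : ℕ) (t : ℝ) : ℝ := -Real.log (levelInvol N t)

theorem measurable_negLogInvol (N : ℕ) : Measurable (negLogInvol N) :=
  (measurable_levelInvol N).log.neg

theorem mem_complexMinusPosNat_of_re_lt_one {α : ℂ} (hα : α.re < 1) : α ∈ complexMinusPosNat := by
  rintro n hn rfl
  have : (1 : ℝ) ≤ n := by exact_mod_cast hn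
  simp only [Complex.natCast_re] at hα
  linarith

/-- The general term of the level `N` series at a real point. -/
def realLevelTerm (N : ℕ) {r : ℕ} (K : Fin r → ℕ) (α : ℝ) (n : decTuples r) : ℝ :=
  (N : ℝ) ^ r / ∏ i, (levelEntry N n.1 i - α) ^ K i

theorem ofReal_realLevelTerm (N : ℕ) {r : ℕ} (K : Fin r → ℕ) (α : ℝ) (n : decTuples r) :
    ((realLevelTerm N K α n : ℝ) : ℂ) = levelTerm N K α n := by
  simp [realLevelTerm, levelTerm]

theorem realLevelTerm_nonneg {N : ℕ} (hN : 1 ≤ N) {r : ℕ} (K : Fin r → ℕ) {α : ℝ} (hα : α < 1)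
    (n : decTuples r) : 0 ≤ realLevelTerm N K α n :=
  div_nonneg (by positivity) (Finset.prod_nonneg fun i _ =>
    pow_nonneg (by linarith [one_le_levelEntry hN n.2 i]) _)

section

variable {w : ℕ} {N : ℕ} (c : Composition w)

theorem lintegral_polylogDensity (hw : 0 < w) (hN : N = 1 ∨ N = 2) {α : ℝ} (hα : α < 1) :
    ∫⁻ t in Ioo (0 : ℝ) 1, polylogDensity N c.blocksFun t
        * ENNReal.ofReal (levelInvol N t ^ (-α))
      = ∑' n, ENNReal.ofReal (realLevelTerm N (dualExponents c) α n) := by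
  have hN1 : 1 ≤ N := by omega
  have h1 := lintegral_iterInt_duality hN1 (g := fun t => ENNReal.ofReal (t ^ (-α)))
    (by fun_prop) (compWord (List.ofFn c.blocksFun)) [] false
  rw [Bool.not_false, ← compWord_dualExponents hw c,
    iterInt_compWord hN hα _ (dualExponents_pos c) 1 ⟨one_pos, le_rfl⟩] at h1
  simp only [Real.one_rpow, mul_one] at h1
  simp only [realLevelTerm]
  rw [← h1]
  refine lintegral_congr fun t => ?_
  simp only [polylogDensity, levelPolylog, iterInt, formDensity]
  ring

theorem summable_realLevelTerm (hw : 0 < w) (hN : 1 ≤ N) {α : ℝ} (hα : α < 1) :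
    Summable (realLevelTerm N (dualExponents c) α) := by
  have := summable_levelTerm hN (length_hoffmanDual_pos hw c.reverse) (dualExponents_pos c)
    (two_le_dualExponents c) (mem_complexMinusPosNat_of_re_lt_one (α := α) (by simpa using hα))
  exact Complex.summable_ofReal.1 (this.congr fun n => (ofReal_realLevelTerm N _ α n).symm)

theorem exp_mul_negLogInvol (hN : 1 ≤ N) {t : ℝ} (ht : t ∈ Ioo (0 : ℝ) 1) (α : ℝ) :
    Real.exp (α * negLogInvol N t) = levelInvol N t ^ (-α) := by
  rw [Real.rpow_def_of_pos (levelInvol_pos hN ht.1.le ht.2), negLogInvol]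
  ring_nf

theorem lintegral_exp_polylogMeasure (hw : 0 < w) (hN : N = 1 ∨ N = 2) {α : ℝ} (hα : α < 1) :
    ∫⁻ t, ENNReal.ofReal (Real.exp (α * negLogInvol N t)) ∂polylogMeasure N c.blocksFun
      = ENNReal.ofReal (∑' n, realLevelTerm N (dualExponents c) α n) := by
  have hN1 : 1 ≤ N := by omega
  rw [polylogMeasure, lintegral_withDensity_eq_lintegral_mul _ (measurable_polylogDensity N _)
    (((measurable_negLogInvol N).const_mul α).exp.ennreal_ofReal),
    ENNReal.ofReal_tsum_of_nonneg (realLevelTerm_nonneg hN1 _ hα)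
      (summable_realLevelTerm c hw hN1 hα), ← lintegral_polylogDensity c hw hN hα]
  refine setLIntegral_congr_fun measurableSet_Ioo fun t ht => ?_
  simp only [Pi.mul_apply]
  rw [exp_mul_negLogInvol hN1 ht]

theorem mem_integrableExpSet (hw : 0 < w) (hN : N = 1 ∨ N = 2) {α : ℝ} (hα : α < 1) :
    α ∈ ProbabilityTheory.integrableExpSet (negLogInvol N) (polylogMeasure N c.blocksFun) := by
  refine ⟨((measurable_negLogInvol N).const_mul α).exp.aestronglyMeasurable, ?_⟩
  rw [hasFiniteIntegral_iff_ofReal (Filter.Eventually.of_forall fun t => (Real.exp_pos _).le),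
    lintegral_exp_polylogMeasure c hw hN hα]
  exact ENNReal.ofReal_lt_top

theorem re_mem_interior_integrableExpSet (hw : 0 < w) (hN : N = 1 ∨ N = 2) {α : ℂ}
    (hα : α.re < 1) :
    α.re ∈ interior
      (ProbabilityTheory.integrableExpSet (negLogInvol N) (polylogMeasure N c.blocksFun)) :=
  interior_maximal (fun _ hx => mem_integrableExpSet c hw hN hx) isOpen_Iio hα

theorem complexMGF_ofReal_eq_levelSum (hw : 0 < w) (hN : N = 1 ∨ N = 2) {α : ℝ} (hα : α < 1) :
    ProbabilityTheory.complexMGF (negLogInvol N) (polylogMeasure N c.blocksFun) α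
      = levelSum N (dualExponents c) α := by
  have hN1 : 1 ≤ N := by omega
  rw [ProbabilityTheory.complexMGF_ofReal, ProbabilityTheory.mgf,
    integral_eq_lintegral_of_nonneg_ae (Filter.Eventually.of_forall fun t => (Real.exp_pos _).le)
    ((measurable_negLogInvol N).const_mul α).exp.aestronglyMeasurable,
    lintegral_exp_polylogMeasure c hw hN hα,
    ENNReal.toReal_ofReal (tsum_nonneg (realLevelTerm_nonneg hN1 _ hα)), Complex.ofReal_tsum,
    levelSum]
  exact tsum_congr fun n => ofReal_realLevelTerm N _ α n

theorem complexMGF_eqOn_levelSum (hw : 0 < w) (hN : N = 1 ∨ N = 2) :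
    EqOn (ProbabilityTheory.complexMGF (negLogInvol N) (polylogMeasure N c.blocksFun))
      (levelSum N (dualExponents c)) {α : ℂ | α.re < 1} := by
  have hN1 : 1 ≤ N := by omega
  refine AnalyticOnNhd.eqOn_of_preconnected_of_frequently_eq (z₀ := 0)
    (ProbabilityTheory.analyticOnNhd_complexMGF.mono
      fun α hα => re_mem_interior_integrableExpSet c hw hN hα)
    (((differentiableOn_levelSum hN1 (length_hoffmanDual_pos hw c.reverse) (dualExponents_pos c)
      (two_le_dualExponents c)).analyticOnNhd isOpen_complexMinusPosNat).mono
      fun α hα => mem_complexMinusPosNat_of_re_lt_one hα)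
    (convex_halfSpace_re_lt 1).isPreconnected (by simp) ?_
  -- Real points accumulate at 0, and agreement there is enough for the identity theorem on the
  -- half-plane.
  have ht : Filter.Tendsto (fun t : ℝ => (t : ℂ)) (nhdsWithin 0 {0}ᶜ) (nhdsWithin 0 {0}ᶜ) := by
    refine tendsto_nhdsWithin_iff.2 ⟨?_, ?_⟩
    · exact (Complex.continuous_ofReal.tendsto' 0 0 (by simp)).mono_left nhdsWithin_le_nhds
    · filter_upwards [self_mem_nhdsWithin] with t ht
      simpa using ht
  refine ht.frequently (Filter.Eventually.frequently ?_)
  filter_upwards [nhdsWithin_le_nhds (Iio_mem_nhds (zero_lt_one (α := ℝ)))] with t ht1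
  exact complexMGF_ofReal_eq_levelSum c hw hN ht1

/-- The total mass is the convergent series at α = 0. Almost everywhere finiteness allows passing
from the measure with this density to an integral against its real value. -/
theorem polylogDensity_lt_top (hw : 0 < w) (hN : N = 1 ∨ N = 2) :
    ∀ᵐ t ∂volume.restrict (Ioo (0 : ℝ) 1), polylogDensity N c.blocksFun t < ∞ := by
  have hN1 : 1 ≤ N := by omega
  refine ae_lt_top (measurable_polylogDensity N _) ?_
  have h := lintegral_polylogDensity c hw hN (α := 0) zero_lt_one
  rw [← ENNReal.ofReal_tsum_of_nonneg (realLevelTerm_nonneg hN1 _ zero_lt_one)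
    (summable_realLevelTerm c hw hN1 zero_lt_one)] at h
  simp only [neg_zero, Real.rpow_zero, ENNReal.ofReal_one, mul_one] at h
  rw [h]
  exact ENNReal.ofReal_ne_top

/-- The integrand of the level `N` formula. -/
def levelIntegrand (N : ℕ) {r : ℕ} (k : Fin r → ℕ) (m : ℕ) (α : ℂ) (x : ℝ) : ℂ :=
  (((levelPolylog N k x).toReal * Real.log (levelInvol N x) ^ m : ℝ) : ℂ) /
    ((x : ℂ) * ((levelInvol N x : ℝ) : ℂ) ^ α)

theorem levelIntegrand_eq (hN : 1 ≤ N) {r : ℕ} (k : Fin r → ℕ) (m : ℕ) (α : ℂ) {x : ℝ}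
    (hx : x ∈ Ioo (0 : ℝ) 1) :
    levelIntegrand N k m α x = (-1) ^ m * ((polylogDensity N k x).toReal •
      ((negLogInvol N x : ℂ) ^ m * Complex.exp (α * negLogInvol N x))) := by
  have h0 := levelInvol_pos hN hx.1.le hx.2
  have h0' : ((levelInvol N x : ℝ) : ℂ) ≠ 0 := by exact_mod_cast h0.ne'
  have h1 : (polylogDensity N k x).toReal = (levelPolylog N k x).toReal / x := by
    rw [polylogDensity, ENNReal.toReal_mul, ENNReal.toReal_ofReal (one_div_pos.2 hx.1).le]
    ring
  have h2 : Complex.exp (α * negLogInvol N x) = (((levelInvol N x : ℝ) : ℂ) ^ α)⁻¹ := by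
    rw [Complex.cpow_def_of_ne_zero h0', ← Complex.exp_neg, ← Complex.ofReal_log h0.le,
      negLogInvol]
    congr 1
    push_cast
    ring
  rw [h1, h2, levelIntegrand, negLogInvol, Complex.real_smul]
  push_cast
  rw [neg_pow (Complex.ofReal _)]
  have h3 : ((-1 : ℂ) ^ m) * (-1) ^ m = 1 := by rw [← mul_pow]; simp
  rw [div_eq_mul_inv, mul_inv]
  linear_combination (-((levelPolylog N k x).toReal : ℂ) * (x : ℂ)⁻¹ *
    (Real.log (levelInvol N x) : ℂ) ^ m * (((levelInvol N x : ℝ) : ℂ) ^ α)⁻¹) * h3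

theorem integrableOn_levelIntegrand (hw : 0 < w) (hN : N = 1 ∨ N = 2) (m : ℕ) {α : ℂ}
    (hα : α.re < 1) :
    IntegrableOn (levelIntegrand N c.blocksFun m α) (Ioo 0 1) := by
  have hN1 : 1 ≤ N := by omega
  have h := ProbabilityTheory.integrable_pow_mul_cexp_of_re_mem_interior_integrableExpSet
    (re_mem_interior_integrableExpSet c hw hN hα) m
  rw [polylogMeasure, integrable_withDensity_iff_integrable_smul' (measurable_polylogDensity N _)
    (polylogDensity_lt_top c hw hN)] at h
  refine (h.const_mul ((-1) ^ m)).congr ?_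
  filter_upwards [ae_restrict_mem measurableSet_Ioo] with t ht
  exact (levelIntegrand_eq hN1 _ m α ht).symm

theorem integral_levelIntegrand (hw : 0 < w) (hN : N = 1 ∨ N = 2) (m : ℕ) {α : ℂ}
    (hα : α.re < 1) :
    ∫ x in Ioo 0 1, levelIntegrand N c.blocksFun m α x
      = (-1) ^ m * iteratedDeriv m (levelSum N (dualExponents c)) α := by
  have hN1 : 1 ≤ N := by omega
  have hopen : IsOpen {α : ℂ | α.re < 1} := isOpen_lt Complex.continuous_re continuous_const
  have hev := Filter.eventuallyEq_of_mem (hopen.mem_nhds hα) (complexMGF_eqOn_levelSum c hw hN)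
  rw [← hev.iteratedDeriv_eq m, ProbabilityTheory.iteratedDeriv_complexMGF
    (re_mem_interior_integrableExpSet c hw hN hα), polylogMeasure,
    integral_withDensity_eq_integral_toReal_smul (measurable_polylogDensity N _)
    (polylogDensity_lt_top c hw hN), ← integral_const_mul]
  exact setIntegral_congr_fun measurableSet_Ioo fun t ht => levelIntegrand_eq hN1 _ m α ht

end

/-! ### Continuation and the two levels -/

/-- The common form of both formulas, for an integrand and a series that agree with those of
level `N`. -/
theorem exists_continuation {w : ℕ} (hw : 0 < w) (c : Composition w) (m : ℕ) {N : ℕ}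
    (hN : N = 1 ∨ N = 2) {f : ℂ → ℝ → ℂ}
    {term : (Fin (hoffmanDual c.reverse).length → ℕ) → ℂ →
      decTuples (hoffmanDual c.reverse).length → ℂ}
    (hf : ∀ α, ∀ x ∈ Ioo (0 : ℝ) 1, f α x = levelIntegrand N c.blocksFun m α x)
    (hterm : ∀ K α n, term K (1 - α) n = levelTerm N K α n) :
    ∃ F : ℂ → ℂ,
      DifferentiableOn ℂ F complexMinusPosNat ∧
      (∀ α : ℂ, α.re < 1 → IntervalIntegrable (f α) volume 0 1 ∧ F α = ∫ x in (0 : ℝ)..1, f α x) ∧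
      ∀ α ∈ complexMinusPosNat,
        (∀ j ∈ Finset.Nat.antidiagonalTuple (hoffmanDual c.reverse).length m,
          Summable (term (dualExponents c + j) (1 - α))) ∧
        F α = (-1) ^ m * (m.factorial : ℂ) *
          ∑ j ∈ Finset.Nat.antidiagonalTuple (hoffmanDual c.reverse).length m,
            (binomProd (dualExponents c) j : ℂ) * ∑' n, term (dualExponents c + j) (1 - α) n := by
  have hN1 : 1 ≤ N := by omega
  have hr := length_hoffmanDual_pos hw c.reverse
  -- The sign converts powers of X = -log φ into powers of log φ.
  refine ⟨fun α => (-1) ^ m * iteratedDeriv m (levelSum N (dualExponents c)) α,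
    (differentiableOn_iteratedDeriv_levelSum hN1 hr (dualExponents_pos c)
      (two_le_dualExponents c) m).const_mul _, fun α hα => ⟨?_, ?_⟩, fun α hα => ⟨fun j _ => ?_, ?_⟩⟩
  · rw [intervalIntegrable_iff_integrableOn_Ioo_of_le zero_le_one]
    exact (integrableOn_levelIntegrand c hw hN m hα).congr_fun
      (fun x hx => (hf α x hx).symm) measurableSet_Ioo
  · rw [intervalIntegral.integral_of_le zero_le_one, integral_Ioc_eq_integral_Ioo,
      setIntegral_congr_fun measurableSet_Ioo (hf α), integral_levelIntegrand c hw hN m hα]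
  · refine (summable_levelTerm hN1 hr (fun i => Nat.add_pos_left (dualExponents_pos c i) (j i))
      (fun i hi => (two_le_dualExponents c i hi).trans (Nat.le_add_right _ (j i))) hα).congr
      fun n => ?_
    exact (hterm _ α n).symm
  · simp only [iteratedDeriv_levelSum hN1 hr (dualExponents_pos c) (two_le_dualExponents c) m hα,
      hterm, mul_assoc]
    rfl

theorem hurwitzZetaTerm_one_sub {r : ℕ} (K : Fin r → ℕ) (α : ℂ) (n : decTuples r) :
    hurwitzZetaTerm K (1 - α) n = levelTerm 1 K α n := by
  simp only [hurwitzZetaTerm, levelTerm, Nat.cast_one, one_pow]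
  congr 1
  refine Finset.prod_congr rfl fun i _ => ?_
  congr 1
  simp [levelEntry]
  ring

theorem hurwitzTTerm_one_sub {r : ℕ} (K : Fin r → ℕ) (α : ℂ) (n : decTuples r) :
    hurwitzTTerm K (1 - α) n = levelTerm 2 K α n := by
  simp only [hurwitzTTerm, levelTerm, Nat.cast_ofNat]
  congr 1
  refine Finset.prod_congr rfl fun i _ => ?_
  congr 1
  simp [levelEntry]
  ring

theorem toReal_levelPolylog_one {r : ℕ} {k : Fin r → ℕ} (hk : ∀ i, 0 < k i) {x : ℝ}
    (hx : x ∈ Ioo (0 : ℝ) 1) : (levelPolylog 1 k x).toReal = multiPolylog k x := by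
  rw [toReal_levelPolylog (Or.inl rfl) hk hx, multiPolylog]
  refine tsum_congr fun n => ?_
  have h : levelFirst 1 n.1 = (firstEntry n.1 : ℝ) := by simp [levelFirst]
  rw [h, Real.rpow_natCast]
  simp [levelEntry]
  ring

theorem double_sub_mem_parityTuples {r : ℕ} {n : Fin r → ℕ} (hn : n ∈ decTuples r) :
    (fun i : Fin r => 2 * n i - (r - (i : ℕ))) ∈ parityTuples r := by
  have h := sub_le_of_mem_decTuples hn
  refine ⟨⟨?_, fun i => ?_⟩, fun i => ?_⟩
  · cases r with
    | zero => exact fun i => i.elim0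
    | succ r =>
      rw [Fin.strictAnti_iff_succ_lt]
      intro i
      have h1 : n i.succ < n i.castSucc := hn.1 Fin.castSucc_lt_succ
      have h2 := h i.castSucc
      simp only [Fin.val_succ, Fin.val_castSucc] at h2 ⊢
      omega
  · have := hn.2 i
    have := h i
    have := i.2
    dsimp only
    omega
  · have := h i
    simp only [Nat.ModEq]
    omega

theorem half_add_mem_decTuples {r : ℕ} {n : Fin r → ℕ} (hn : n ∈ parityTuples r) :
    (fun i : Fin r => (n i + (r - (i : ℕ))) / 2) ∈ decTuples r := by
  refine ⟨?_, fun i => ?_⟩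
  · cases r with
    | zero => exact fun i => i.elim0
    | succ r =>
      rw [Fin.strictAnti_iff_succ_lt]
      intro i
      have h1 : n i.succ < n i.castSucc := hn.1.1 Fin.castSucc_lt_succ
      have h2 := hn.2 i.castSucc
      have h3 := hn.2 i.succ
      simp only [Fin.val_succ, Fin.val_castSucc, Nat.ModEq] at h2 h3 ⊢
      omega
  · have := hn.1.2 i
    have := i.2
    dsimp only
    omega

/-- The bijection `nᵢ ↦ 2 nᵢ - (r - i)` onto the tuples of alternating parity. -/
def parityEquiv (r : ℕ) : decTuples r ≃ parityTuples r where
  toFun n := ⟨_, double_sub_mem_parityTuples n.2⟩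
  invFun n := ⟨_, half_add_mem_decTuples n.2⟩
  left_inv n := by
    ext i
    have := sub_le_of_mem_decTuples n.2 i
    simp only
    omega
  right_inv n := by
    ext i
    have := n.2.2 i
    simp only [Nat.ModEq] at this ⊢
    omega

theorem levelEntry_two_eq {r : ℕ} (n : decTuples r) (i : Fin r) :
    levelEntry 2 n.1 i = ((parityEquiv r n).1 i : ℝ) := by
  have h := sub_le_of_mem_decTuples n.2 i
  simp only [parityEquiv, Equiv.coe_fn_mk, levelEntry]
  rw [Nat.cast_sub (by omega), Nat.cast_sub i.2.le]
  push_cast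
  ring

theorem levelFirst_two_eq {r : ℕ} (n : decTuples r) :
    levelFirst 2 n.1 = (firstEntry (parityEquiv r n).1 : ℝ) := by
  cases r with
  | zero => simp [levelFirst, firstEntry]
  | succ r => rw [levelFirst_succ, levelEntry_two_eq, firstEntry_succ]

theorem toReal_levelPolylog_two {r : ℕ} {k : Fin r → ℕ} (hk : ∀ i, 0 < k i) {x : ℝ}
    (hx : x ∈ Ioo (0 : ℝ) 1) : (levelPolylog 2 k x).toReal = multiA k x := by
  rw [toReal_levelPolylog (Or.inr rfl) hk hx, multiA, ← (parityEquiv r).tsum_eq, ← tsum_mul_left]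
  refine tsum_congr fun n => ?_
  rw [levelFirst_two_eq, Real.rpow_natCast]
  simp only [levelEntry_two_eq, Nat.cast_ofNat]
  ring

theorem mainTheorem1 {w : ℕ} (hw : 0 < w) (c : Composition w) (m : ℕ) (hm : 0 < m) :
    -- the depth of the dual exponents, over which the sums below run
    (hoffmanDual c.reverse).length = w + 1 - c.length ∧
    -- the formula for multiple polylogarithms
    (∃ F : ℂ → ℂ,
      DifferentiableOn ℂ F complexMinusPosNat ∧
      (∀ α : ℂ, α.re < 1 →
        IntervalIntegrable (polylogIntegrand c.blocksFun m α) MeasureTheory.volume 0 1 ∧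
        F α = ∫ x in (0 : ℝ)..1, polylogIntegrand c.blocksFun m α x) ∧
      ∀ α ∈ complexMinusPosNat,
        (∀ j ∈ Finset.Nat.antidiagonalTuple (hoffmanDual c.reverse).length m,
          Summable (hurwitzZetaTerm (dualExponents c + j) (1 - α))) ∧
        F α = (-1) ^ m * (m.factorial : ℂ) *
          ∑ j ∈ Finset.Nat.antidiagonalTuple (hoffmanDual c.reverse).length m,
            (binomProd (dualExponents c) j : ℂ) * hurwitzMZV (dualExponents c + j) (1 - α)) ∧
    -- the formula for the level two functions
    (∃ G : ℂ → ℂ,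
      DifferentiableOn ℂ G complexMinusPosNat ∧
      (∀ α : ℂ, α.re < 1 →
        IntervalIntegrable (multiAIntegrand c.blocksFun m α) MeasureTheory.volume 0 1 ∧
        G α = ∫ x in (0 : ℝ)..1, multiAIntegrand c.blocksFun m α x) ∧
      ∀ α ∈ complexMinusPosNat,
        (∀ j ∈ Finset.Nat.antidiagonalTuple (hoffmanDual c.reverse).length m,
          Summable (hurwitzTTerm (dualExponents c + j) (1 - α))) ∧
        G α = (-1) ^ m * (m.factorial : ℂ) *
          ∑ j ∈ Finset.Nat.antidiagonalTuple (hoffmanDual c.reverse).length m,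
            (binomProd (dualExponents c) j : ℂ) * hurwitzMTV (dualExponents c + j) (1 - α)) := by
  have hk : ∀ i, 0 < c.blocksFun i := fun i => c.one_le_blocksFun i
  refine ⟨length_hoffmanDual_reverse hw c,
    exists_continuation hw c m (Or.inl rfl) (fun α x hx => ?_) hurwitzZetaTerm_one_sub,
    exists_continuation hw c m (Or.inr rfl) (fun α x hx => ?_) hurwitzTTerm_one_sub⟩
  · simp [polylogIntegrand, levelIntegrand, toReal_levelPolylog_one hk hx, levelInvol]
  · have h : levelInvol 2 x = (1 - x) / (1 + x) := by
      rw [levelInvol]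
      norm_num
    rw [multiAIntegrand, levelIntegrand, toReal_levelPolylog_two hk hx, h]

end
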